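/- Let $R$ be a valuation domain, i.e. a commutative domain whose ideals are totally ordered by inclusion. \emph{Homological epimorphisms.} A homological epimorphism originating at $R$ is a ring homomorphism $f\colon R\to S$ to an associative unital ring $S$ which is an epimorphism in the category of rings and satisfies $\operatorname{Tor}^R_n(S,S)=0$ for all $n\ge 1$ (then $S$ is necessarily commutative). Two of them, $f\colon R\to S$ and $f'\colon R\to S'$, are equivalent if there is a ring isomorphism $\varphi\colon S\to S'$ with $f'=\varphi f$. \emph{Intervals.} An admissible interval $[\mathfrak i,\mathfrak p]$ consists of prime ideals $\mathfrak i\subseteq\mathfrak p$ of $R$ with $\mathfrak i^2=\mathfrak i$. The set $\operatorname{Inter}R$ of admissible intervals is partially ordered by $[\mathfrak i,\mathfrak p]<[\mathfrak i',\mathfrak p']$ if and only if $\mathfrak p\subsetneq\mathfrak i'$. For a homological epimorphism $f\colon R\to S$, let $\mathcal I(f)$ be the set of all admissible intervals $[\mathfrak j,\mathfrak q]$ for which there is a maximal ideal $\mathfrak n$ of $S$ such that $\mathfrak q=f^{-1}(\mathfrak n)$ and the composition $R\to S\to S_{\mathfrak n}$ is equivalent to the canonical map $R\to R_{\mathfrak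 q}/\mathfrak j$ (where $\mathfrak j$ stands for $\mathfrak jR_{\mathfrak q}$). \emph{Closure conditions.} For a chain $\mathcal I\subseteq\operatorname{Inter}R$ consider: \begin{enumerate} \item[(C1)] If $\{[\mathfrak j_\ell,\mathfrak q_\ell]\mid \ell\in\Lambda\}$ is a non-empty subset of $\mathcal I$ with no minimal element, then $\mathcal I$ contains an element of the form $[\mathfrak j,\bigcap_{\ell}\mathfrak q_\ell]$. \item[(C2)] If $\{[\mathfrak j_\ell,\mathfrak q_\ell]\mid \ell\in\Lambda\}$ is a non-empty subset of $\mathcal I$ with no maximal element, then $\mathcal I$ contains an element of the form $[\bigcup_{\ell}\mathfrak j_\ell,\mathfrak q]$. \item[(C3)] For any $[\mathfrak j_0,\mathfrak q_0]<[\mathfrak j_1,\mathfrak q_1]$ in $\mathcal I$ there are $[\mathfrak j,\mathfrak q],[\mathfrak j',\mathfrak q']$ in $\mathcal I$ with $[\mathfrak j_0,\mathfrak q_0]\le[\mathfrak j,\mathfrak q]<[\mathfrak j',\mathfrak q']\le[\mathfrak j_1,\mathfrak q_1]$ and no element of $\mathcal I$ strictly between $[\mathfrak j,\mathfrak q]$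 and $[\mathfrak j',\mathfrak q']$. \end{enumerate} \emph{The ring $R_{(\mathcal I)}$.} Let $\mathcal I\ne\emptyset$ be a chain satisfying (C1)--(C3), and put $R_{\mathcal I}=\prod_{[\mathfrak j,\mathfrak q]\in\mathcal I}R_{\mathfrak q}/\mathfrak j$. For each partition $\mathcal I=\mathcal I_0\cup\dots\cup\mathcal I_n$ into finitely many pieces such that every $\mathcal I_\ell$ has a least element $[\mathfrak i_\ell,\mathfrak p_\ell]$ and a greatest element $[\mathfrak i'_\ell,\mathfrak n_\ell]$, and every element of $\mathcal I_k$ is smaller than every element of $\mathcal I_\ell$ whenever $k<\ell$, there is a canonical ring homomorphism $\prod_{\ell=0}^nR_{\mathfrak n_\ell}/\mathfrak i_\ell\to R_{\mathcal I}$ whose component at $[\mathfrak j,\mathfrak q]\in\mathcal I_\ell$ is the canonical map $R_{\mathfrak n_\ell}/\mathfrak i_\ell\to R_{\mathfrak q}/\mathfrak j$. Let $R_{(\mathcal I)}\subseteq R_{\mathcal I}$ be the direct union of the images of these homomorphisms over all such partitions, and let $f_{(\mathcal I)}\colon R\to R_{(\mathcal I)}$ be the canonical homomorphism. For $\mathcal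 I=\emptyset$ let $f_{(\mathcal I)}$ be $R\to 0$. \textbf{Theorem.} For every chain $\mathcal I\subseteq\operatorname{Inter}R$ satisfying (C1)--(C3) the map $f_{(\mathcal I)}$ is a homological epimorphism, and the assignment $\mathcal I\mapsto f_{(\mathcal I)}$ is a bijection between \begin{enumerate} \item[(i)] chains $\mathcal I\subseteq\operatorname{Inter}R$ satisfying (C1)--(C3), and \item[(ii)] equivalence classes of homological epimorphisms $f\colon R\to S$. \end{enumerate} Its inverse sends the class of $f$ to $\mathcal I(f)$. -/

import Mathlib

open CategoryTheory

universe u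

noncomputable section

namespace HomEpiVD

/-! ### Homological epimorphisms of rings -/

section HomologicalEpi

variable {R S : Type u} [CommRing R] [Ring S]

/-- The ring `S` as a left `R`-module through `f`, that is, `r • s = f r * s`. -/
def leftModule (f : R →+* S) : ModuleCat.{u} R :=
  (ModuleCat.restrictScalars f).obj (ModuleCat.of S S)

/-- The ring `S` as a right `R`-module through `f`, that is, `r • s = s * f r`; as `R` is
commutative, right `R`-modules are the same as `R`-modules. -/
def rightModule (f : R →+* S) : ModuleCat.{u} R :=
  (ModuleCat.restrictScalars (f.toOpposite fun x y => (Commute.all x y).map f)).obj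
    (ModuleCat.of Sᵐᵒᵖ S)

/-- A homological epimorphism from a commutative ring `R` to an associative unital ring `S`: an
epimorphism in the category of (not necessarily commutative) rings with
`Tor_n^R(S, S) = 0` for all `n ≥ 1`. -/
structure IsHomologicalEpi (f : R →+* S) : Prop where
  epi : Epi (RingCat.ofHom f)
  isZero_tor : ∀ n : ℕ, 1 ≤ n →
    Limits.IsZero (((Tor (ModuleCat.{u} R) n).obj (rightModule f)).obj (leftModule f))

/-- An element that commutes with the image of a ring epimorphism is central: conjugate the
diagonal embedding of `S` into the 2 × 2 matrices by an elementary matrix. -/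
theorem commute_of_epi (f : R →+* S) (hf : Epi (RingCat.ofHom f)) (c : S)
    (hc : ∀ r, c * f r = f r * c) (s : S) : c * s = s * c := by
  let U : Matrix (Fin 2) (Fin 2) S := !![1, c; 0, 1]
  let V : Matrix (Fin 2) (Fin 2) S := !![1, -c; 0, 1]
  have hUV : U * V = 1 := by
    ext i j; fin_cases i <;> fin_cases j <;> simp [U, V, Matrix.mul_apply]
  have hVU : V * U = 1 := by
    ext i j; fin_cases i <;> fin_cases j <;> simp [U, V, Matrix.mul_apply]
  let d : S →+* Matrix (Fin 2) (Fin 2) S := Matrix.scalar (Fin 2)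
  let d' : S →+* Matrix (Fin 2) (Fin 2) S :=
    { toFun := fun x => U * d x * V
      map_one' := by simp [hUV]
      map_zero' := by simp
      map_add' := fun x y => by simp [mul_add, add_mul]
      map_mul' := fun x y => by
        calc U * d (x * y) * V = U * d x * (1 : Matrix (Fin 2) (Fin 2) S) * d y * V := by
              simp [mul_assoc]
          _ = _ := by rw [← hVU]; simp only [mul_assoc] }
  have key : RingCat.ofHom f ≫ RingCat.ofHom d' = RingCat.ofHom f ≫ RingCat.ofHom d := by
    ext r i j
    have := hc r
    fin_cases i <;> fin_cases j <;> simp [d, d', U, V, this]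
  have h := (cancel_epi (RingCat.ofHom f)).1 key
  have h' : d' s = d s := by
    have := congrArg (fun φ => φ.hom s) h
    simpa using this
  have h01 : d' s 0 1 = d s 0 1 := by rw [h']
  have : -(s * c) + c * s = 0 := by
    simpa [d, d', U, V, Matrix.mul_apply] using h01
  exact (neg_add_eq_zero.1 this).symm

/-- The target of a ring epimorphism from a commutative ring is commutative. -/
theorem mul_comm_of_epi (f : R →+* S) (hf : Epi (RingCat.ofHom f)) (a b : S) :
    a * b = b * a :=
  commute_of_epi f hf a
    (fun r => (commute_of_epi f hf (f r) (fun r' => by rw [← map_mul, mul_comm, map_mul]) a).symm) b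

end HomologicalEpi

/-- A homological epimorphism originating at `R`, with arbitrary (associative unital) target. -/
structure HomEpi (R : Type u) [CommRing R] where
  target : Type u
  [ring : Ring target]
  hom : R →+* target
  isHomologicalEpi : IsHomologicalEpi hom

attribute [instance] HomEpi.ring

/-- Bundle a homological epimorphism `f : R → S`. -/
abbrev HomEpi.of {R S : Type u} [CommRing R] [Ring S] (f : R →+* S) (h : IsHomologicalEpi f) :
    HomEpi R where
  target := S
  hom := f
  isHomologicalEpi := h

/-- Two epimorphisms `R → S` and `R → S'` are equivalent if there is a ring isomorphism `S ≅ S'`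
compatible with them. -/
instance homEpiSetoid (R : Type u) [CommRing R] : Setoid (HomEpi R) where
  r F G := ∃ e : F.target ≃+* G.target, ∀ r, e (F.hom r) = G.hom r
  iseqv :=
    { refl := fun F => ⟨RingEquiv.refl _, fun _ => rfl⟩
      symm := fun ⟨e, he⟩ => ⟨e.symm, fun r => by simp [← he]⟩
      trans := fun ⟨e, he⟩ ⟨e', he'⟩ => ⟨e.trans e', fun r => by simp [he, he']⟩ }

/-- Equivalence classes of homological epimorphisms originating at `R`. -/
abbrev HomEpiClass (R : Type u) [CommRing R] := Quotient (homEpiSetoid R)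

/-- The target of a homological epimorphism from `R` as a commutative ring. -/
abbrev HomEpi.commRing {R : Type u} [CommRing R] (F : HomEpi R) : CommRing F.target :=
  { F.ring with mul_comm := mul_comm_of_epi F.hom F.isHomologicalEpi.epi }

/-! ### Admissible intervals -/

/-- An admissible interval `[𝔦, 𝔭]` in `Spec R`: prime ideals `𝔦 ⊆ 𝔭` with `𝔦² = 𝔦`. -/
@[ext]
structure AdmissibleInterval (R : Type u) [CommRing R] where
  lo : PrimeSpectrum R
  hi : PrimeSpectrum R
  idem : lo.asIdeal ^ 2 = lo.asIdeal
  le : lo.asIdeal ≤ hi.asIdeal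

/-- The order on admissible intervals: `[𝔦, 𝔭] < [𝔦', 𝔭']` if and only if `𝔭 ⊊ 𝔦'`. -/
instance (R : Type u) [CommRing R] : PartialOrder (AdmissibleInterval R) where
  lt A B := A.hi.asIdeal < B.lo.asIdeal
  le A B := A = B ∨ A.hi.asIdeal < B.lo.asIdeal
  le_refl A := Or.inl rfl
  le_trans A B C := by
    rintro (rfl | h) (rfl | h')
    · exact Or.inl rfl
    · exact Or.inr h'
    · exact Or.inr h
    · exact Or.inr (h.trans_le (B.le.trans h'.le))
  le_antisymm A B := by
    rintro (rfl | h) (h' | h')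
    · rfl
    · rfl
    · exact h'.symm
    · exact absurd (h.trans_le (B.le.trans (h'.le.trans A.le))) (lt_irrefl _)
  lt_iff_le_not_ge A B := by
    constructor
    · intro h
      refine ⟨Or.inr h, ?_⟩
      rintro (rfl | h')
      · exact absurd (h.trans_le B.le) (lt_irrefl _)
      · exact absurd (h.trans_le (B.le.trans (h'.le.trans A.le))) (lt_irrefl _)
    · rintro ⟨rfl | h, h'⟩
      · exact absurd (Or.inl rfl) h'
      · exact h

section Intervals

variable {R : Type u} [CommRing R]

theorem AdmissibleInterval.lo_mono {A B : AdmissibleInterval R} (h : A ≤ B) : A.lo ≤ B.lo := by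
  rcases h with rfl | h
  · exact le_rfl
  · exact A.le.trans h.le

theorem AdmissibleInterval.hi_mono {A B : AdmissibleInterval R} (h : A ≤ B) : A.hi ≤ B.hi := by
  rcases h with rfl | h
  · exact le_rfl
  · exact h.le.trans B.le

/-- A chain of admissible intervals that satisfies the closure conditions (C1), (C2), (C3). -/
structure IsClosedChain (I : Set (AdmissibleInterval R)) : Prop where
  isChain : IsChain (· ≤ ·) I
  /-- (C1): a non-empty subset without minimal element has an element `[𝔧, ⋂ 𝔮_ℓ]` of the chain
  attached to it. -/
  c1 : ∀ T ⊆ I, T.Nonempty → (¬ ∃ A, Minimal (· ∈ T) A) →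
    ∃ K ∈ I, (K.hi.asIdeal : Set R) = ⋂ A ∈ T, (A.hi.asIdeal : Set R)
  /-- (C2): a non-empty subset without maximal element has an element `[⋃ 𝔧_ℓ, 𝔮]` of the chain
  attached to it. -/
  c2 : ∀ T ⊆ I, T.Nonempty → (¬ ∃ A, Maximal (· ∈ T) A) →
    ∃ K ∈ I, (K.lo.asIdeal : Set R) = ⋃ A ∈ T, (A.lo.asIdeal : Set R)
  /-- (C3): between any two elements of the chain there is a jump. -/
  c3 : ∀ A ∈ I, ∀ B ∈ I, A < B →
    ∃ C ∈ I, ∃ D ∈ I, A ≤ C ∧ C < D ∧ D ≤ B ∧ ¬ ∃ E ∈ I, C < E ∧ E < D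

/-! ### The rings `R_𝔮 / 𝔧` and the intervals of a homological epimorphism -/

/-- The ring `R_𝔮 / 𝔧`, with `𝔧` standing for its extension `𝔧 R_𝔮`. -/
abbrev LocQuot (j q : PrimeSpectrum R) : Type u :=
  Localization.AtPrime q.asIdeal ⧸
    j.asIdeal.map (algebraMap R (Localization.AtPrime q.asIdeal))

/-- The canonical map `R_𝔮' / 𝔧' → R_𝔮 / 𝔧` for `𝔧' ⊆ 𝔧` and `𝔮 ⊆ 𝔮'`. -/
def LocQuot.map {j' q' j q : PrimeSpectrum R} (hj : j' ≤ j) (hq : q ≤ q') :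
    LocQuot j' q' →ₐ[R] LocQuot j q :=
  Ideal.Quotient.liftₐ _
    ((Ideal.Quotient.mkₐ R (j.asIdeal.map (algebraMap R (Localization.AtPrime q.asIdeal)))).comp
      (IsLocalization.liftAlgHom (M := q'.asIdeal.primeCompl)
        (f := Algebra.ofId R (Localization.AtPrime q.asIdeal))
        (fun y => IsLocalization.map_units (Localization.AtPrime q.asIdeal)
          (⟨y.1, fun h => y.2 (hq h)⟩ : q.asIdeal.primeCompl))))
    (by
      intro a ha
      refine (RingHom.mem_ker (f := AlgHom.toRingHom _)).1 (Ideal.map_le_iff_le_comap.2 ?_ ha)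
      intro x hx
      rw [Ideal.mem_comap, RingHom.mem_ker]
      refine (AlgHom.commutes _ x).trans ?_
      exact Ideal.Quotient.eq_zero_iff_mem.2 (Ideal.mem_map_of_mem _ (hj hx)))

/-- The set `𝓘(f)` of a ring homomorphism `f : R → S` of commutative rings: all admissible
intervals `[𝔧, 𝔮]` such that, for some maximal ideal `𝔫` of `S`, `𝔮 = f⁻¹(𝔫)` and the composite
`R → S → S_𝔫` is equivalent to the canonical map `R → R_𝔮 / 𝔧`. -/
def intervalsOf {S : Type u} [CommRing S] (f : R →+* S) : Set (AdmissibleInterval R) :=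
  {A | ∃ (n : Ideal S) (_ : n.IsMaximal), A.hi.asIdeal = n.comap f ∧
    ∃ e : Localization.AtPrime n ≃+* LocQuot A.lo A.hi,
      ∀ r, e (algebraMap S (Localization.AtPrime n) (f r)) = algebraMap R (LocQuot A.lo A.hi) r}

/-- The set `𝓘(f)` of a homological epimorphism `f` originating at `R`. -/
def HomEpi.intervals (F : HomEpi R) : Set (AdmissibleInterval R) :=
  letI := F.commRing
  intervalsOf F.hom

/-! ### The ring `R_(𝓘)` -/

/-- A partition of a set `I` of admissible intervals into finitely many successive pieces, each
with a smallest element `[𝔦_ℓ, 𝔭_ℓ]` and a greatest element `[𝔦'_ℓ, 𝔫_ℓ]`. -/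
structure IntervalPartition (I : Set (AdmissibleInterval R)) where
  num : ℕ
  part : Fin num → Set (AdmissibleInterval R)
  iUnion_part : ⋃ l, part l = I
  bot : Fin num → AdmissibleInterval R
  top : Fin num → AdmissibleInterval R
  isLeast_bot : ∀ l, IsLeast (part l) (bot l)
  isGreatest_top : ∀ l, IsGreatest (part l) (top l)
  lt_of_lt : ∀ k l, k < l → ∀ A ∈ part k, ∀ B ∈ part l, A < B

/-- The product `R_𝓘 = ∏ R_𝔮 / 𝔧` over all `[𝔧, 𝔮] ∈ 𝓘`. -/
abbrev ProdRing (I : Set (AdmissibleInterval R)) : Type u :=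
  ∀ A : I, LocQuot A.1.lo A.1.hi

namespace IntervalPartition

variable {I : Set (AdmissibleInterval R)} (P : IntervalPartition I)

theorem exists_mem_part (A : I) : ∃ l, A.1 ∈ P.part l :=
  Set.mem_iUnion.1 (P.iUnion_part.symm ▸ A.2)

/-- The index of the (unique) piece that contains `A`. -/
def index (A : I) : Fin P.num := (P.exists_mem_part A).choose

theorem mem_part_index (A : I) : A.1 ∈ P.part (P.index A) := (P.exists_mem_part A).choose_spec

/-- The canonical map `∏_ℓ R_{𝔫_ℓ} / 𝔦_ℓ → R_𝓘`; its component at `[𝔧, 𝔮]` in the `ℓ`-th piece is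
the canonical map `R_{𝔫_ℓ} / 𝔦_ℓ → R_𝔮 / 𝔧`. -/
def toProd : (∀ l, LocQuot (P.bot l).lo (P.top l).hi) →ₐ[R] ProdRing I :=
  AlgHom.pi fun A =>
    (LocQuot.map
      (AdmissibleInterval.lo_mono ((P.isLeast_bot _).2 (P.mem_part_index A)))
      (AdmissibleInterval.hi_mono ((P.isGreatest_top _).2 (P.mem_part_index A)))).comp
    (Pi.evalAlgHom R _ (P.index A))

end IntervalPartition

/-- The ring `R_(𝓘)`: the direct union of the images of the maps `∏_ℓ R_{𝔫_ℓ} / 𝔦_ℓ → R_𝓘`, over all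
finite partitions of `𝓘` as above. For a chain `𝓘` any two partitions have a common refinement, so
these subrings are directed and their supremum is their union. For `𝓘 = ∅` this is the zero
ring. -/
def chainRing (I : Set (AdmissibleInterval R)) : Subalgebra R (ProdRing I) :=
  ⨆ P : IntervalPartition I, P.toProd.range

/-- The canonical ring homomorphism `f_(𝓘) : R → R_(𝓘)`. -/
def chainHom (I : Set (AdmissibleInterval R)) : R →+* chainRing I :=
  algebraMap R (chainRing I)

end Intervals

end HomEpiVD

end

/-! Over a valuation domain submodules of flat modules are flat, so `Tor` vanishes from degree two
on and only `Tor_1(S, S)` matters. For an epimorphism this condition says that the annihilator in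
`R` of every element of `S` is idempotent: `IsHomologicalEpi.isIdem_torsionOf`, with the converse
`isHomologicalEpi_of_isIdem_torsionOf` once `S` is locally made of fractions of elements of `R`.
Proper idempotent ideals of a valuation domain are prime, which ties annihilators to `Spec R`.

From `f` to intervals: let `T` be the localization of `S` at a maximal ideal over `q`. The kernel
`j` of `R → T` is a union of annihilators, hence idempotent and prime. A quotient of `T` by a prime
over `j` turns out to be `R_q / j`, and the epimorphism property promotes this to `T ≅ R_q / j`
(`exists_isLocalPiece`). An epimorphism is injective on spectra, so distinct intervals are disjoint
and form a chain. (C1) and (C2) follow because a prime `p` with `pS ∩ R = p` lies in some interval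
(`exists_interval_of_prime`); (C3) comes from the annihilator of one element of `S` that separates
the two given intervals.

From a chain `I` to a ring: `R_(I)` consists of the families that are a single fraction `a / v` on
each piece of a finite partition of `I`. (C1) and (C2) give suprema and infima in `I`, and (C3)
gives enough jumps to cut `I`, so that `I` behaves like a compact, totally disconnected space. Hence
the maximal ideals of `R_(I)` are exactly the points of `I`, with local rings `R_q / j`
(`exists_isLocalPiece_of_isMaximal`). The epimorphism property and the idempotency of annihilators
are checked on partitions.

The two constructions are inverse: `S` embeds in the product of its local rings, and its image is
`R_(I)` (`HasPieces.range_eq`). Both inclusions are local-to-global arguments, with idempotents of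
`S` produced from elements of `R` lying in the gaps of `I`. -/

noncomputable section

namespace HomEpiVD

open TensorProduct

/-! ### Ideals of valuation rings -/

section Valuation

variable {R : Type u} [CommRing R]

/-- An ideal all of whose elements are products of two elements of the ideal. -/
def IsIdem (I : Ideal R) : Prop := ∀ x ∈ I, ∃ y ∈ I, ∃ z ∈ I, x = y * z

theorem IsIdem.sq_eq {I : Ideal R} (h : IsIdem I) : I ^ 2 = I := by
  refine le_antisymm (Ideal.pow_le_self two_ne_zero) fun x hx => ?_
  obtain ⟨y, hy, z, hz, rfl⟩ := h x hx
  rw [sq]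
  exact Ideal.mul_mem_mul hy hz

theorem isIdem_top : IsIdem (⊤ : Ideal R) := fun x _ => ⟨x, trivial, 1, trivial, by simp⟩

variable [IsDomain R] [ValuationRing R]

theorem ideal_le_total (I J : Ideal R) : I ≤ J ∨ J ≤ I :=
  (ValuationRing.le_total_ideal (A := R)).total I J

theorem ideal_lt_or_le (I J : Ideal R) : I < J ∨ J ≤ I := by
  rcases ideal_le_total I J with h | h
  · by_cases h' : J ≤ I
    · exact Or.inr h'
    · exact Or.inl (lt_of_le_not_ge h h')
  · exact Or.inr h

/-- Of two coefficients one divides the other, so a finite sum of products collapses to a single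
product. -/
theorem exists_smul_of_mem_ideal_smul {M : Type*} [AddCommGroup M] [Module R M] {I : Ideal R}
    {N : Submodule R M} {y : M} (hy : y ∈ I • N) : ∃ x ∈ I, ∃ m ∈ N, y = x • m := by
  induction hy using Submodule.smul_induction_on' with
  | smul r hr n hn => exact ⟨r, hr, n, hn, rfl⟩
  | add a _ b _ ha hb =>
    obtain ⟨x, hx, m, hm, rfl⟩ := ha
    obtain ⟨x', hx', m', hm', rfl⟩ := hb
    rcases ValuationRing.dvd_total x x' with ⟨c, rfl⟩ | ⟨c, rfl⟩
    · exact ⟨x, hx, m + c • m', N.add_mem hm (N.smul_mem _ hm'), by rw [smul_add, mul_smul]⟩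
    · exact ⟨x', hx', c • m + m', N.add_mem (N.smul_mem _ hm) hm', by rw [smul_add, mul_smul]⟩

theorem exists_mul_of_mem_map {S : Type*} [CommRing S] [Algebra R S] {I : Ideal R} {y : S}
    (hy : y ∈ I.map (algebraMap R S)) : ∃ x ∈ I, ∃ s : S, y = algebraMap R S x * s := by
  have h : y ∈ I • (⊤ : Submodule R S) := by
    rw [Ideal.smul_top_eq_map]; exact hy
  obtain ⟨x, hx, m, -, rfl⟩ := exists_smul_of_mem_ideal_smul h
  exact ⟨x, hx, m, Algebra.smul_def _ _⟩

theorem isIdem_of_sq_eq {I : Ideal R} (h : I ^ 2 = I) : IsIdem I := fun x hx => by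
  rw [← h, sq, ← smul_eq_mul] at hx
  obtain ⟨y, hy, z, hz, rfl⟩ := exists_smul_of_mem_ideal_smul hx
  exact ⟨y, hy, z, hz, rfl⟩

/-- If `a, b ∉ I` but `ab = xy` with `x, y ∈ I`, then `a` and `b` properly divide `x` and `y`;
cancelling the nonzero `ab` makes a product of two nonunits equal to `1`. -/
theorem IsIdem.isPrime {I : Ideal R} (h : IsIdem I) (hI : I ≠ ⊤) : I.IsPrime := by
  refine ⟨hI, fun {a b} hab => ?_⟩
  by_contra! hcon
  obtain ⟨ha, hb⟩ := hcon
  obtain ⟨x, hx, y, hy, hxy⟩ := h _ hab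
  have key : ∀ a ∉ I, ∀ x ∈ I, ∃ c, x = a * c ∧ ¬ IsUnit c := by
    intro a ha x hx
    rcases ValuationRing.dvd_total a x with ⟨c, rfl⟩ | ⟨c, rfl⟩
    · refine ⟨c, rfl, fun hc => ha ?_⟩
      exact (Ideal.mul_unit_mem_iff_mem I hc).1 hx
    · exact absurd (I.mul_mem_right c hx) ha
  obtain ⟨c, rfl, hc⟩ := key a ha x hx
  obtain ⟨d, rfl, hd⟩ := key b hb y hy
  have ha0 : a ≠ 0 := fun h => ha (h ▸ I.zero_mem)
  have hb0 : b ≠ 0 := fun h => hb (h ▸ I.zero_mem)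
  have : c * d = 1 := by
    apply mul_left_cancel₀ (mul_ne_zero ha0 hb0)
    rw [mul_one]
    linear_combination -hxy
  exact hc (IsUnit.of_mul_eq_one d this)

end Valuation

/-! ### Epimorphisms of commutative rings -/

section Epi

/-- Epimorphisms in the category of commutative rings. -/
def CEpi {R S : Type u} [CommRing R] [CommRing S] (f : R →+* S) : Prop :=
  ∀ (T : Type u) [CommRing T] (g h : S →+* T), g.comp f = h.comp f → g = h

variable {R S T : Type u} [CommRing R] [CommRing S] [CommRing T]

theorem CEpi.comp {f : R →+* S} {g : S →+* T} (hg : CEpi g) (hf : CEpi f) : CEpi (g.comp f) :=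
  fun X _ a b hab => hg X a b (hf X _ _ (by simpa [RingHom.comp_assoc] using hab))

theorem CEpi.of_comp {f : R →+* S} {g : S →+* T} (h : CEpi (g.comp f)) : CEpi g :=
  fun X _ a b hab => h X a b (by rw [← RingHom.comp_assoc, hab, RingHom.comp_assoc])

theorem cEpi_of_surjective {f : R →+* S} (hf : Function.Surjective f) : CEpi f :=
  fun X _ a b hab => by
    ext s
    obtain ⟨r, rfl⟩ := hf s
    exact RingHom.congr_fun hab r

theorem cEpi_of_isLocalization [Algebra R S] (M : Submonoid R) [IsLocalization M S] :
    CEpi (algebraMap R S) :=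
  fun _ _ _ _ hab => IsLocalization.ringHom_ext M hab

theorem cEpi_of_epi {f : R →+* S} (hf : Epi (RingCat.ofHom f)) : CEpi f := by
  intro X _ a b hab
  have h : RingCat.ofHom f ≫ RingCat.ofHom a = RingCat.ofHom f ≫ RingCat.ofHom b := by
    ext r
    exact RingHom.congr_fun hab r
  have := (cancel_epi (RingCat.ofHom f)).1 h
  ext s
  exact congrArg (fun φ => φ.hom s) this

/-- An epimorphism originating at a field is surjective. -/
theorem CEpi.surjective_of_field {K T : Type u} [Field K] [CommRing T] {f : K →+* T}
    (hf : CEpi f) : Function.Surjective f := by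
  let _ := f.toAlgebra
  intro t
  by_contra hcon
  -- The two inclusions of `T` into `T ⊗ T` agree on `K`, hence everywhere. If `t` were not in the
  -- line spanned by `1`, a functional that kills `1` but not `t` would contradict this unless `T =
  -- 0`.
  have key : (1 : T) ⊗ₜ[K] t = t ⊗ₜ[K] (1 : T) := by
    have := hf (T ⊗[K] T) Algebra.TensorProduct.includeRight.toRingHom
      (Algebra.TensorProduct.includeLeftRingHom) (by
        ext k
        exact (AlgHom.commutes (Algebra.TensorProduct.includeRight (R := K) (A := T) (B := T)) k))
    exact RingHom.congr_fun this t
  have ht : t ∉ Submodule.span K {(1 : T)} := by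
    rw [Submodule.mem_span_singleton]
    rintro ⟨k, rfl⟩
    exact hcon ⟨k, by rw [Algebra.smul_def, mul_one]; rfl⟩
  obtain ⟨φ, hφt, hφ⟩ := Submodule.exists_le_ker_of_notMem ht
  have h1 : φ 1 = 0 := hφ (Submodule.mem_span_singleton_self _)
  have h2 := congrArg (fun z => TensorProduct.lid K T (TensorProduct.map φ LinearMap.id z)) key
  simp only [TensorProduct.map_tmul, TensorProduct.lid_tmul, h1, LinearMap.id_apply, zero_smul]
    at h2
  have h3 : (1 : T) = 0 := by
    rcases smul_eq_zero.1 h2.symm with h | h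
    · exact absurd h hφt
    · exact h
  have : Subsingleton T := subsingleton_of_zero_eq_one h3.symm
  exact hcon ⟨0, Subsingleton.elim _ _⟩

/-- The fibre ring `L` of `S` over `p` receives an epimorphism from the residue field of `p`, which
is surjective. So the image of `s` in `L` is a fraction `r / v`; clearing the denominators of `L`
gives the congruence modulo `pS`. -/
theorem CEpi.exists_mul_sub_mem_map [Algebra R S] (hf : CEpi (algebraMap R S)) (p : Ideal R)
    [p.IsPrime] (s : S) : ∃ v ∉ p, ∃ r : R,
      algebraMap R S v * s - algebraMap R S r ∈ p.map (algebraMap R S) := by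
  let J := p.map (algebraMap R S)
  let Q := S ⧸ J
  let M : Submonoid Q := p.primeCompl.map (algebraMap R Q)
  let L := Localization M
  let g : R →+* L := (algebraMap Q L).comp ((Ideal.Quotient.mk J).comp (algebraMap R S))
  have hg : CEpi g := (cEpi_of_isLocalization M).comp
    ((cEpi_of_surjective Ideal.Quotient.mk_surjective).comp hf)
  have h1 : p ≤ RingHom.ker g := fun x hx => by
    have : Ideal.Quotient.mk J (algebraMap R S x) = 0 :=
      Ideal.Quotient.eq_zero_iff_mem.2 (Ideal.mem_map_of_mem _ hx)
    rw [RingHom.mem_ker, RingHom.comp_apply, RingHom.comp_apply, this, map_zero]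
  have h2 : p.primeCompl ≤ (IsUnit.submonoid L).comap g := fun x hx =>
    IsLocalization.map_units L (⟨algebraMap R Q x, x, hx, rfl⟩ : M)
  let k : p.ResidueField →+* L := Ideal.ResidueField.lift p g h1 h2
  have hk : k.comp (algebraMap R p.ResidueField) = g := by
    ext r; exact Ideal.ResidueField.lift_algebraMap p g h1 h2 r
  have hk' : CEpi k := CEpi.of_comp (f := algebraMap R p.ResidueField) (by rw [hk]; exact hg)
  obtain ⟨c, hc⟩ := hk'.surjective_of_field (algebraMap Q L (Ideal.Quotient.mk J s))
  obtain ⟨r, v, hv, hrv⟩ : ∃ r v : R, v ∉ p ∧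
      algebraMap R p.ResidueField v * c = algebraMap R p.ResidueField r := by
    obtain ⟨a, b, hb, rfl⟩ := IsFractionRing.div_surjective (R ⧸ p) c
    obtain ⟨a, rfl⟩ := Ideal.Quotient.mk_surjective a
    obtain ⟨b, rfl⟩ := Ideal.Quotient.mk_surjective b
    have hb' : b ∉ p := fun h => nonZeroDivisors.ne_zero hb (Ideal.Quotient.eq_zero_iff_mem.2 h)
    refine ⟨a, b, hb', ?_⟩
    have e : ∀ x : R, algebraMap (R ⧸ p) p.ResidueField (Ideal.Quotient.mk p x) =
        algebraMap R p.ResidueField x := fun x => rfl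
    rw [e, e, mul_div_cancel₀]
    rwa [Ne, Ideal.algebraMap_residueField_eq_zero]
  have h3 : g v * algebraMap Q L (Ideal.Quotient.mk J s) = g r := by
    rw [← hc, ← hk, RingHom.comp_apply, RingHom.comp_apply, ← map_mul, hrv]
  have h4 : algebraMap Q L (Ideal.Quotient.mk J (algebraMap R S v * s)) =
      algebraMap Q L (Ideal.Quotient.mk J (algebraMap R S r)) := by
    rw [map_mul, map_mul]; exact h3
  obtain ⟨⟨_, w, hw, rfl⟩, h5⟩ := (IsLocalization.eq_iff_exists M L).1 h4
  refine ⟨w * v, ?_, w * r, ?_⟩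
  · exact fun h => ((inferInstance : p.IsPrime).mem_or_mem h).elim hw hv
  · have h6 : Ideal.Quotient.mk J (algebraMap R S w * (algebraMap R S v * s)) =
        Ideal.Quotient.mk J (algebraMap R S w * algebraMap R S r) := by
      rw [map_mul, map_mul _ _ (algebraMap R S r)]; exact h5
    rw [map_mul, map_mul, mul_assoc]
    exact Ideal.Quotient.eq.1 h6

/-- An epimorphism induces an injective map on spectra. -/
theorem CEpi.prime_eq_of_comap_eq [Algebra R S] (hf : CEpi (algebraMap R S)) {P Q : Ideal S}
    [P.IsPrime] [hQ : Q.IsPrime] (h : P.comap (algebraMap R S) = Q.comap (algebraMap R S)) :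
    P = Q := by
  have key : ∀ {P Q : Ideal S} [P.IsPrime] [Q.IsPrime],
      P.comap (algebraMap R S) = Q.comap (algebraMap R S) → P ≤ Q := by
    intro P Q _ hQ h s hs
    obtain ⟨v, hv, r, hr⟩ := hf.exists_mul_sub_mem_map (P.comap (algebraMap R S)) s
    have hrP : r ∈ P.comap (algebraMap R S) := by
      have := P.sub_mem (P.mul_mem_left (algebraMap R S v) hs) (Ideal.map_comap_le hr)
      rwa [sub_sub_cancel] at this
    have hrQ : algebraMap R S r ∈ Q := by rw [h] at hrP; exact hrP
    rw [h] at hr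
    have h1 := Q.add_mem (Ideal.map_comap_le hr) hrQ
    rw [sub_add_cancel] at h1
    refine (hQ.mem_or_mem h1).resolve_left fun h2 => hv ?_
    rw [h]; exact h2
  exact le_antisymm (key h) (key h.symm)

end Epi

open TensorProduct

/-! ### Vanishing of Tor over valuation domains -/

section Tor

variable {R : Type u} [CommRing R] [IsDomain R] [ValuationRing R]

/-- Over a Bézout domain flat means torsion-free, and this passes to submodules. -/
theorem flat_submodule {P : Type*} [AddCommGroup P] [Module R P] [Module.Flat R P]
    (K : Submodule R P) : Module.Flat R K := by
  rw [Module.Flat.flat_iff_torsion_eq_bot_of_isBezout, ← Submodule.isTorsionFree_iff_torsion_eq_bot]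
  have h : Submodule.torsion R P = ⊥ := Module.Flat.torsion_eq_bot
  rw [← Submodule.isTorsionFree_iff_torsion_eq_bot] at h
  infer_instance

omit [ValuationRing R] in
theorem smul_eq_zero_of_flat {P : Type*} [AddCommGroup P] [Module R P] [Module.Flat R P]
    {x : R} {p : P} (h : x • p = 0) : x = 0 ∨ p = 0 := by
  have h' : Submodule.torsion R P = ⊥ := Module.Flat.torsion_eq_bot
  rw [← Submodule.isTorsionFree_iff_torsion_eq_bot] at h'
  exact smul_eq_zero.1 h

-- The cyclic module `Rw ≅ R / ann(w)` embeds in `M`, and by flatness `(R / ann(w)) ⊗ P = P /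
-- ann(w)P` embeds in `M ⊗ P`.
omit [IsDomain R] [ValuationRing R] in
theorem mem_torsionOf_smul_top_of_tmul_eq_zero {M P : Type u} [AddCommGroup M] [Module R M]
    [AddCommGroup P] [Module R P] [Module.Flat R P] {w : M} {k : P} (h : w ⊗ₜ[R] k = 0) :
    k ∈ Ideal.torsionOf R M w • (⊤ : Submodule R P) := by
  let I := Ideal.torsionOf R M w
  let i : (R ⧸ I) →ₗ[R] M := (R ∙ w).subtype ∘ₗ
    (Ideal.quotTorsionOfEquivSpanSingleton R M w).toLinearMap
  have hi : Function.Injective i :=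
    (R ∙ w).subtype_injective.comp (Ideal.quotTorsionOfEquivSpanSingleton R M w).injective
  have h1 := Module.Flat.rTensor_preserves_injective_linearMap (M := P) i hi
  have h2 : (1 : R ⧸ I) ⊗ₜ[R] k = 0 := by
    apply h1
    rw [map_zero, LinearMap.rTensor_tmul]
    have : i (Submodule.Quotient.mk 1) = w := by
      have h3 := Ideal.quotTorsionOfEquivSpanSingleton_apply_mk (R := R) w 1
      exact (congrArg Subtype.val h3).trans (one_smul R w)
    change i 1 = w at this
    rw [this, h]
  have h3 := congrArg (TensorProduct.quotTensorEquivQuotSMul P I) h2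
  rw [TensorProduct.quotTensorEquivQuotSMul_mk_one_tmul, map_zero] at h3
  exact (Submodule.Quotient.mk_eq_zero _).1 h3

-- Right exactness identifies `M ⊗ range g` with the cokernel of `M ⊗ f`, so the homology in the
-- middle is the kernel of `M ⊗ range g → M ⊗ C`.
omit [IsDomain R] [ValuationRing R] in
theorem lTensor_exact_iff_injective {M A B C : Type u} [AddCommGroup M] [Module R M]
    [AddCommGroup A] [Module R A] [AddCommGroup B] [Module R B] [AddCommGroup C] [Module R C]
    {f : A →ₗ[R] B} {g : B →ₗ[R] C} (h : Function.Exact f g) :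
    Function.Exact (f.lTensor M) (g.lTensor M) ↔
      Function.Injective ((LinearMap.range g).subtype.lTensor M) := by
  have h1 : Function.Exact f g.rangeRestrict := fun b => by
    rw [← h b, Subtype.ext_iff]; rfl
  have h2 := lTensor_exact M h1 g.surjective_rangeRestrict
  have h3 : ∀ z, g.lTensor M z =
      (LinearMap.range g).subtype.lTensor M (g.rangeRestrict.lTensor M z) := fun z => by
    rw [← LinearMap.comp_apply, ← LinearMap.lTensor_comp]; rfl
  constructor
  · intro h4
    rw [injective_iff_map_eq_zero]
    intro z hz
    obtain ⟨y, rfl⟩ := LinearMap.lTensor_surjective M g.surjective_rangeRestrict z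
    rw [← h3] at hz
    exact (h2 y).2 ((h4 y).1 hz)
  · intro h4 y
    rw [← h2 y, h3]
    exact (map_eq_zero_iff _ h4)

omit [IsDomain R] [ValuationRing R] in
theorem isZero_tor_iff_exact (M N : ModuleCat.{u} R) (n : ℕ) (P : ProjectiveResolution N) :
    Limits.IsZero (((Tor (ModuleCat.{u} R) (n + 1)).obj M).obj N) ↔
    Function.Exact ((P.complex.d (n + 2) (n + 1)).hom.lTensor M)
      ((P.complex.d (n + 1) n).hom.lTensor M) := by
  refine (P.isoLeftDerivedObj ((MonoidalCategory.tensoringLeft (ModuleCat.{u} R)).obj M)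
    (n + 1)).isZero_iff.trans ?_
  erw [← HomologicalComplex.exactAt_iff_isZero_homology]
  rw [HomologicalComplex.exactAt_iff' _ (n + 2) (n + 1) n (by simp) (by simp),
    ShortComplex.ShortExact.moduleCat_exact_iff_function_exact]
  rfl

omit [IsDomain R] [ValuationRing R] in
theorem projectiveResolution_exact {N : ModuleCat.{u} R} (P : ProjectiveResolution N) (n : ℕ) :
    Function.Exact (P.complex.d (n + 2) (n + 1)).hom (P.complex.d (n + 1) n).hom :=
  (ShortComplex.ShortExact.moduleCat_exact_iff_function_exact _).1 (P.exact_succ n)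

omit [IsDomain R] [ValuationRing R] in
theorem projectiveResolution_exact_zero {N : ModuleCat.{u} R} (P : ProjectiveResolution N) :
    Function.Exact (P.complex.d 1 0).hom (P.π.f 0).hom := by
  have h := ShortComplex.exact_of_g_is_cokernel
    (ShortComplex.mk (P.complex.d 1 0) (P.π.f 0) P.complex_d_comp_π_f_zero)
    P.isColimitCokernelCofork
  exact (ShortComplex.ShortExact.moduleCat_exact_iff_function_exact _).1 h

omit [IsDomain R] [ValuationRing R] in
theorem projectiveResolution_flat {N : ModuleCat.{u} R} (P : ProjectiveResolution N) (n : ℕ) :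
    Module.Flat R (P.complex.X n) := by
  have h : Projective (ModuleCat.of R (P.complex.X n)) := P.projective n
  have := (IsProjective.iff_projective (P.complex.X n)).2 h
  infer_instance

/-- Over a valuation domain, `Tor_n` vanishes for `n ≥ 2`. -/
theorem isZero_tor_add_two (M N : ModuleCat.{u} R) (n : ℕ) :
    Limits.IsZero (((Tor (ModuleCat.{u} R) (n + 2)).obj M).obj N) := by
  let P := projectiveResolution N
  have := projectiveResolution_flat P n
  have := flat_submodule (LinearMap.range (P.complex.d (n + 1) n).hom)
  -- The cokernel of the inclusion of the second syzygy is a submodule of the flat `P.complex.X n`,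
  -- hence flat, so the inclusion stays injective after tensoring. This needs two steps of the
  -- resolution, hence degree at least two.
  rw [isZero_tor_iff_exact M N (n + 1) P,
    lTensor_exact_iff_injective (projectiveResolution_exact P (n + 1))]
  refine LinearMap.lTensor_injective_of_exact_of_flat
    (P.complex.d (n + 1) n).hom.rangeRestrict (LinearMap.surjective_rangeRestrict _)
    (LinearMap.range (P.complex.d (n + 2) (n + 1)).hom).subtype
    (Submodule.subtype_injective _) (fun b => ?_) _
  have h := projectiveResolution_exact P n b
  rw [Subtype.ext_iff]
  refine h.trans ⟨fun ⟨a, ha⟩ => ⟨⟨b, a, ha⟩, rfl⟩, ?_⟩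
  rintro ⟨⟨_, a, ha⟩, rfl⟩
  exact ⟨a, ha⟩

omit [IsDomain R] [ValuationRing R] in
/-- `Tor_1` in terms of a flat presentation. -/
theorem exists_presentation (N : ModuleCat.{u} R) :
    ∃ (P : Type u) (_ : AddCommGroup P) (_ : Module R P) (_ : Module.Flat R P) (p : P →ₗ[R] N),
      Function.Surjective p ∧ ∀ M : ModuleCat.{u} R,
        Limits.IsZero (((Tor (ModuleCat.{u} R) 1).obj M).obj N) ↔
          Function.Injective ((LinearMap.ker p).subtype.lTensor M) := by
  let P := projectiveResolution N
  refine ⟨P.complex.X 0, inferInstance, inferInstance, projectiveResolution_flat P 0,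
    (P.π.f 0).hom, (ModuleCat.epi_iff_surjective _).1 inferInstance, fun M => ?_⟩
  have h : LinearMap.ker (P.π.f 0).hom = LinearMap.range (P.complex.d 1 0).hom :=
    (LinearMap.exact_iff.1 (projectiveResolution_exact_zero P))
  rw [isZero_tor_iff_exact M N 0 P, lTensor_exact_iff_injective (projectiveResolution_exact P 0)]
  exact iff_of_eq (by rw [← h]; rfl)


/-- If `Tor_1(S, S) = 0` then the annihilator of every element of `S` is idempotent. -/
theorem isIdem_torsionOf_of_injective {S P : Type u} [AddCommGroup S] [Module R S]
    [AddCommGroup P] [Module R P] [Module.Flat R P] {p : P →ₗ[R] S} (hp : Function.Surjective p)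
    (h : Function.Injective ((LinearMap.ker p).subtype.lTensor S)) (s : S) :
    IsIdem (Ideal.torsionOf R S s) := by
  intro x hx
  rw [Ideal.mem_torsionOf_iff] at hx
  obtain ⟨y, rfl⟩ := hp s
  have := flat_submodule (LinearMap.ker p)
  have hk : x • y ∈ LinearMap.ker p := by rw [LinearMap.mem_ker, map_smul, hx]
  -- In `S ⊗ P` the factor `x` may be moved to `s`, which it kills; the hypothesis brings the
  -- vanishing back to `S ⊗ ker p`. As `ker p` is flat, `x • y = a • m` with `a` in the annihilator
  -- of `s`, and comparing `x` with `a` by divisibility gives the factorization.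
  have h1 : p y ⊗ₜ[R] (⟨x • y, hk⟩ : LinearMap.ker p) = 0 := by
    apply h
    rw [map_zero, LinearMap.lTensor_tmul, Submodule.subtype_apply, TensorProduct.tmul_smul,
      TensorProduct.smul_tmul', hx, TensorProduct.zero_tmul]
  obtain ⟨a, ha, m, -, hm⟩ :=
    exists_smul_of_mem_ideal_smul (mem_torsionOf_smul_top_of_tmul_eq_zero h1)
  have hm' : x • y = a • (m : P) := congrArg Subtype.val hm
  have hmk : p m = 0 := m.2
  rcases ValuationRing.dvd_total x a with ⟨c, rfl⟩ | ⟨c, rfl⟩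
  · rcases smul_eq_zero_of_flat (x := x) (p := y - c • (m : P))
      (by rw [smul_sub, ← mul_smul, hm', sub_self]) with h0 | h0
    · exact ⟨0, by simp, 0, by simp, by simp [h0]⟩
    · have : p y = 0 := by rw [sub_eq_zero.1 h0, map_smul, hmk, smul_zero]
      exact ⟨x, by simp [this], 1, by simp [this], by simp⟩
  · rcases smul_eq_zero_of_flat (x := a) (p := c • y - (m : P))
      (by rw [smul_sub, ← mul_smul, hm', sub_self]) with h0 | h0
    · exact ⟨0, by simp, 0, by simp, by simp [h0]⟩
    · refine ⟨a, ha, c, ?_, rfl⟩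
      rw [Ideal.mem_torsionOf_iff, ← map_smul, sub_eq_zero.1 h0, hmk]

/-- This is the purity statement `ker p ∩ IP = I ker p`. Write `k = x • m`, where `x` lies both in
`I` and in the annihilator of `p m`. Splitting `x` inside the smaller of these two idempotent ideals
leaves one factor in `I` and uses the other to push `m` into the kernel. -/
theorem mem_smul_ker_of_isIdem {S P : Type u} [AddCommGroup S] [Module R S]
    [AddCommGroup P] [Module R P] {p : P →ₗ[R] S}
    (hS : ∀ s : S, IsIdem (Ideal.torsionOf R S s)) {I : Ideal R} (hI : IsIdem I) {k : P}
    (hk : p k = 0) (hkI : k ∈ I • (⊤ : Submodule R P)) :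
    ∃ x ∈ I, ∃ m : LinearMap.ker p, k = x • (m : P) := by
  obtain ⟨x, hx, m, -, rfl⟩ := exists_smul_of_mem_ideal_smul hkI
  have hx' : x ∈ Ideal.torsionOf R S (p m) := by rw [Ideal.mem_torsionOf_iff, ← map_smul, hk]
  rcases ideal_le_total I (Ideal.torsionOf R S (p m)) with h | h
  · obtain ⟨y, hy, z, hz, rfl⟩ := hI x hx
    refine ⟨y, hy, ⟨z • m, ?_⟩, mul_smul _ _ _⟩
    rw [LinearMap.mem_ker, map_smul]
    exact (Ideal.mem_torsionOf_iff _ _).1 (h hz)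
  · obtain ⟨y, hy, z, hz, rfl⟩ := hS _ x hx'
    have hy' : y ∈ I ∨ z ∈ I := by
      by_cases hT : I = ⊤
      · left; rw [hT]; trivial
      · exact (hI.isPrime hT).mem_or_mem hx
    rcases hy' with h' | h'
    · refine ⟨y, h', ⟨z • m, ?_⟩, mul_smul _ _ _⟩
      rw [LinearMap.mem_ker, map_smul]
      exact (Ideal.mem_torsionOf_iff _ _).1 hz
    · refine ⟨z, h', ⟨y • m, ?_⟩, by rw [mul_comm, mul_smul]⟩
      rw [LinearMap.mem_ker, map_smul]
      exact (Ideal.mem_torsionOf_iff _ _).1 hy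

/-- If all annihilators of elements of the `R`-algebra `S` are idempotent and `S` is locally a ring
of fractions of a quotient of `R`, then `Tor_1(S, S) = 0`. -/
theorem injective_of_isIdem_torsionOf {S P : Type u} [CommRing S] [Algebra R S]
    [AddCommGroup P] [Module R P] [Module.Flat R P] {p : P →ₗ[R] S}
    (hS : ∀ s : S, IsIdem (Ideal.torsionOf R S s))
    (hloc : ∀ n : Ideal S, n.IsMaximal → ∀ s : S, ∃ w ∉ n, ∃ v : R, algebraMap R S v ∉ n ∧ ∃ b : R,
      w * (algebraMap R S v * s) = w * algebraMap R S b) :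
    Function.Injective ((LinearMap.ker p).subtype.lTensor S) := by
  rw [injective_iff_map_eq_zero]
  intro z hz
  let J : Ideal S := Ideal.torsionOf S (S ⊗[R] LinearMap.ker p) z
  suffices hJ : J = ⊤ by
    have : (1 : S) ∈ J := hJ ▸ trivial
    simpa [J] using this
  by_contra hJ
  obtain ⟨n, hn, hJn⟩ := Ideal.exists_le_maximal J hJ
  have hnp := hn.isPrime
  -- Localized at `n`, scalars from `S` become fractions from `R`, so every tensor reduces to an
  -- elementary one `w ⊗ k`. It remains to kill such a tensor, which is done by purity for the
  -- annihilator of `w`.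
  have key : ∀ z : S ⊗[R] LinearMap.ker p, ∃ w ∉ n, ∃ v : R, algebraMap R S v ∉ n ∧
      ∃ k : LinearMap.ker p, (w * algebraMap R S v) • z = w ⊗ₜ k := by
    intro z
    induction z using TensorProduct.induction_on with
    | zero => exact ⟨1, n.one_notMem, 1, by simpa using n.one_notMem, 0, by simp⟩
    | tmul s k =>
      obtain ⟨w, hw, v, hv, b, hb⟩ := hloc n hn s
      refine ⟨w, hw, v, hv, b • k, ?_⟩
      rw [TensorProduct.smul_tmul', smul_eq_mul, mul_assoc, hb, TensorProduct.tmul_smul,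
        TensorProduct.smul_tmul', Algebra.smul_def, mul_comm]
    | add z₁ z₂ h₁ h₂ =>
      obtain ⟨w₁, hw₁, v₁, hv₁, k₁, h₁⟩ := h₁
      obtain ⟨w₂, hw₂, v₂, hv₂, k₂, h₂⟩ := h₂
      refine ⟨w₁ * w₂, fun h => (hnp.mem_or_mem h).elim hw₁ hw₂, v₁ * v₂, fun h => ?_,
        v₂ • k₁ + v₁ • k₂, ?_⟩
      · rw [map_mul] at h
        exact (hnp.mem_or_mem h).elim hv₁ hv₂
      · have e₁ : (w₁ * w₂ * algebraMap R S (v₁ * v₂)) • z₁ = (w₁ * w₂) ⊗ₜ (v₂ • k₁) := by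
          have : w₁ * w₂ * algebraMap R S (v₁ * v₂) =
              (w₂ * algebraMap R S v₂) * (w₁ * algebraMap R S v₁) := by rw [map_mul]; ring
          rw [this, mul_smul, h₁, TensorProduct.smul_tmul', TensorProduct.tmul_smul,
            TensorProduct.smul_tmul', Algebra.smul_def v₂, smul_eq_mul]
          congr 1; ring
        have e₂ : (w₁ * w₂ * algebraMap R S (v₁ * v₂)) • z₂ = (w₁ * w₂) ⊗ₜ (v₁ • k₂) := by
          have : w₁ * w₂ * algebraMap R S (v₁ * v₂) =
              (w₁ * algebraMap R S v₁) * (w₂ * algebraMap R S v₂) := by rw [map_mul]; ring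
          rw [this, mul_smul, h₂, TensorProduct.smul_tmul', TensorProduct.tmul_smul,
            TensorProduct.smul_tmul', Algebra.smul_def v₁, smul_eq_mul]
          congr 1; ring
        rw [smul_add, e₁, e₂, TensorProduct.tmul_add]
  obtain ⟨w, hw, v, hv, k, hk⟩ := key z
  have h1 : w ⊗ₜ[R] (k : P) = 0 := by
    have h2 : ∀ (c : S) (y : S ⊗[R] LinearMap.ker p),
        (LinearMap.ker p).subtype.lTensor S (c • y) =
          c • (LinearMap.ker p).subtype.lTensor S y := by
      intro c y
      exact (TensorProduct.AlgebraTensorModule.lTensor S S (LinearMap.ker p).subtype).map_smul c y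
    have := h2 (w * algebraMap R S v) z
    rw [hk, hz, smul_zero, LinearMap.lTensor_tmul] at this
    exact this
  obtain ⟨x, hx, m, hm⟩ := mem_smul_ker_of_isIdem hS (hS w) k.2
    (mem_torsionOf_smul_top_of_tmul_eq_zero h1)
  have hkm : k = x • m := Subtype.ext hm
  have h3 : w * algebraMap R S v ∈ J := by
    rw [Ideal.mem_torsionOf_iff, hk, hkm, TensorProduct.tmul_smul, TensorProduct.smul_tmul',
      (Ideal.mem_torsionOf_iff _ _).1 hx, TensorProduct.zero_tmul]
  exact (hnp.mem_or_mem (hJn h3)).elim hw hv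

end Tor

/-! ### Homological epimorphisms in terms of idempotent annihilators -/

section Criterion

variable {R S : Type u} [CommRing R] [CommRing S]

/-- For a commutative ring the two `R`-module structures agree. -/
def rightModuleIso (f : R →+* S) : rightModule f ≅ leftModule f :=
  let e : rightModule f ≃ₗ[R] leftModule f :=
    { AddEquiv.refl S with map_smul' := fun r x => mul_comm (show S from x) (f r) }
  e.toModuleIso

theorem isHomologicalEpi_iff_tor_one [IsDomain R] [ValuationRing R] (f : R →+* S) :
    IsHomologicalEpi f ↔ Epi (RingCat.ofHom f) ∧
      Limits.IsZero (((Tor (ModuleCat.{u} R) 1).obj (leftModule f)).obj (leftModule f)) := by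
  have h : ∀ n, Limits.IsZero (((Tor (ModuleCat.{u} R) n).obj (rightModule f)).obj (leftModule f)) ↔
      Limits.IsZero (((Tor (ModuleCat.{u} R) n).obj (leftModule f)).obj (leftModule f)) := fun n =>
    (((Tor (ModuleCat.{u} R) n).mapIso (rightModuleIso f)).app (leftModule f)).isZero_iff
  constructor
  · exact fun hf => ⟨hf.epi, (h 1).1 (hf.isZero_tor 1 le_rfl)⟩
  · rintro ⟨h1, h2⟩
    refine ⟨h1, fun n hn => (h n).2 ?_⟩
    obtain _ | _ | n := n
    · omega
    · exact h2
    · exact isZero_tor_add_two _ _ n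

theorem IsHomologicalEpi.isIdem_torsionOf [IsDomain R] [ValuationRing R] [Algebra R S]
    (hf : IsHomologicalEpi (algebraMap R S)) (s : S) : IsIdem (Ideal.torsionOf R S s) := by
  have h := ((isHomologicalEpi_iff_tor_one _).1 hf).2
  have hs : ∀ (r : R) (x : S), algebraMap R S r * x = r • x :=
    fun r x => (Algebra.smul_def _ _).symm
  obtain ⟨P, _, _, _, p, hp, hM⟩ := exists_presentation (leftModule (algebraMap R S))
  have h1 := isIdem_torsionOf_of_injective hp ((hM _).1 h) s
  convert h1 using 1
  ext r
  rw [Ideal.mem_torsionOf_iff, ← hs]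
  exact (Ideal.mem_torsionOf_iff (R := R) (M := leftModule (algebraMap R S)) s r).symm

theorem isHomologicalEpi_of_isIdem_torsionOf [IsDomain R] [ValuationRing R] [Algebra R S]
    (hf : Epi (RingCat.ofHom (algebraMap R S))) (hS : ∀ s : S, IsIdem (Ideal.torsionOf R S s))
    (hloc : ∀ n : Ideal S, n.IsMaximal → ∀ s : S, ∃ w ∉ n, ∃ v : R, algebraMap R S v ∉ n ∧ ∃ b : R,
      w * (algebraMap R S v * s) = w * algebraMap R S b) :
    IsHomologicalEpi (algebraMap R S) := by
  refine (isHomologicalEpi_iff_tor_one _).2 ⟨hf, ?_⟩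
  obtain ⟨P, _, _, _, p, hp, hM⟩ := exists_presentation (leftModule (algebraMap R S))
  rw [hM]
  let e : leftModule (algebraMap R S) ≃ₗ[R] S :=
    { AddEquiv.refl S with map_smul' := fun r x => (Algebra.smul_def _ _).symm }
  have h := injective_of_isIdem_torsionOf (p := e.toLinearMap ∘ₗ p) hS hloc
  have hk : LinearMap.ker (e.toLinearMap ∘ₗ p) = LinearMap.ker p := LinearEquiv.ker_comp e p
  rw [hk] at h
  have hcomp : (e.toLinearMap.rTensor P) ∘ₗ
      ((LinearMap.ker p).subtype.lTensor (leftModule (algebraMap R S))) =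
      ((LinearMap.ker p).subtype.lTensor S) ∘ₗ (e.toLinearMap.rTensor (LinearMap.ker p)) := by
    rw [LinearMap.rTensor_comp_lTensor, LinearMap.lTensor_comp_rTensor]
  have h2 : Function.Injective ((e.toLinearMap.rTensor P) ∘ₗ
      ((LinearMap.ker p).subtype.lTensor (leftModule (algebraMap R S)))) := by
    rw [hcomp]
    exact h.comp (LinearEquiv.rTensor (LinearMap.ker p) e).injective
  exact Function.Injective.of_comp h2

end Criterion

/-! ### The rings `R_𝔮 / 𝔧` -/

section LocQuot

variable {R : Type u} [CommRing R]

namespace LocQuot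

variable {j q : PrimeSpectrum R}

theorem isUnit_algebraMap {v : R} (hv : v ∉ q.asIdeal) :
    IsUnit (algebraMap R (LocQuot j q) v) :=
  (IsLocalization.map_units (Localization.AtPrime q.asIdeal)
    (⟨v, hv⟩ : q.asIdeal.primeCompl)).map (Ideal.Quotient.mk _)

theorem exists_frac (t : LocQuot j q) : ∃ a : R, ∃ v ∉ q.asIdeal,
    algebraMap R (LocQuot j q) v * t = algebraMap R (LocQuot j q) a := by
  obtain ⟨t, rfl⟩ := Ideal.Quotient.mk_surjective t
  obtain ⟨⟨a, v⟩, h⟩ := IsLocalization.surj q.asIdeal.primeCompl t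
  refine ⟨a, v, v.2, ?_⟩
  rw [mul_comm]
  exact (map_mul (Ideal.Quotient.mk _) _ _).symm.trans (congrArg (Ideal.Quotient.mk _) h)

theorem exists_mul_eq {v : R} (hv : v ∉ q.asIdeal) (t : LocQuot j q) :
    ∃ s, algebraMap R (LocQuot j q) v * s = t := by
  obtain ⟨w, hw⟩ := isUnit_algebraMap (j := j) hv
  exact ⟨↑w⁻¹ * t, by rw [← hw, Units.mul_inv_cancel_left]⟩

/-- A prime contained in `q` is the contraction of its extension to the localization at `q`. -/
theorem algebraMap_eq_zero_iff (h : j ≤ q) {a : R} :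
    algebraMap R (LocQuot j q) a = 0 ↔ a ∈ j.asIdeal := by
  have h1 := IsLocalization.under_map_of_isPrime_disjoint q.asIdeal.primeCompl
    (Localization.AtPrime q.asIdeal) j.2
    (Set.disjoint_left.2 fun x hx hx' => hx (h hx'))
  exact Ideal.Quotient.eq_zero_iff_mem.trans (SetLike.ext_iff.1 h1 a)

theorem nontrivial (h : j ≤ q) : Nontrivial (LocQuot j q) := by
  refine ⟨0, 1, fun h0 => j.2.one_notMem ?_⟩
  rw [← algebraMap_eq_zero_iff h, map_one, h0]

theorem isUnit_algebraMap_iff (h : j ≤ q) {a : R} :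
    IsUnit (algebraMap R (LocQuot j q) a) ↔ a ∉ q.asIdeal := by
  refine ⟨fun ha haq => ?_, isUnit_algebraMap⟩
  obtain ⟨t, ht⟩ := ha.exists_right_inv
  obtain ⟨b, v, hv, hb⟩ := exists_frac t
  have : algebraMap R (LocQuot j q) (v - a * b) = 0 := by
    rw [map_sub, map_mul, ← hb]
    linear_combination (-algebraMap R (LocQuot j q) v) * ht
  have := h ((algebraMap_eq_zero_iff h).1 this)
  apply hv
  have h2 := q.asIdeal.add_mem this (q.asIdeal.mul_mem_right b haq)
  rwa [sub_add_cancel] at h2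

theorem isUnit_of_frac {t : LocQuot j q} {a v : R} (h : j ≤ q)
    (hv : v ∉ q.asIdeal)
    (hav : algebraMap R (LocQuot j q) v * t = algebraMap R (LocQuot j q) a) :
    IsUnit t ↔ a ∉ q.asIdeal := by
  rw [← isUnit_algebraMap_iff h, ← hav]
  exact ((isUnit_algebraMap hv).mul_left_iff).symm

theorem eq_zero_of_frac {t : LocQuot j q} {a v : R} (h : j ≤ q) (hv : v ∉ q.asIdeal)
    (hav : algebraMap R (LocQuot j q) v * t = algebraMap R (LocQuot j q) a) :
    t = 0 ↔ a ∈ j.asIdeal := by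
  rw [← algebraMap_eq_zero_iff h, ← hav]
  exact ((isUnit_algebraMap hv).mul_right_eq_zero).symm

theorem algebraMap_mul_eq_zero (h : j ≤ q) {a : R} {t : LocQuot j q} :
    algebraMap R (LocQuot j q) a * t = 0 ↔ a ∈ j.asIdeal ∨ t = 0 := by
  obtain ⟨b, v, hv, hb⟩ := exists_frac t
  rw [eq_zero_of_frac h hv hb]
  have h1 : algebraMap R (LocQuot j q) v * (algebraMap R (LocQuot j q) a * t) =
      algebraMap R (LocQuot j q) (a * b) := by rw [map_mul, ← hb]; ring
  rw [eq_zero_of_frac h hv h1, j.2.mul_mem_iff_mem_or_mem]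

theorem isUnit_or_isUnit_one_sub (h : j ≤ q) (t : LocQuot j q) : IsUnit t ∨ IsUnit (1 - t) := by
  obtain ⟨a, v, hv, ha⟩ := exists_frac t
  rw [isUnit_of_frac h hv ha]
  have h1 : algebraMap R (LocQuot j q) v * (1 - t) =
      algebraMap R (LocQuot j q) (v - a) := by rw [map_sub, ← ha]; ring
  rw [isUnit_of_frac h hv h1]
  by_contra! hcon
  exact hv (by simpa using q.asIdeal.add_mem hcon.1 hcon.2)

end LocQuot

/-! ### Local pieces of an algebra -/

/-- The hypothesis says that inverses of units from the image stay in the image; thus the image is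
itself local, with maximal ideal cut out by that of `L`. -/
theorem isMaximal_comap_maximalIdeal {S L : Type*} [CommRing S] [CommRing L] [IsLocalRing L]
    (φ : S →+* L) (h : ∀ x, IsUnit (φ x) → ∃ y, φ x * φ y = 1) :
    ((IsLocalRing.maximalIdeal L).comap φ).IsMaximal := by
  rw [Ideal.isMaximal_iff]
  refine ⟨fun h1 => ?_, fun J x hJ hx hxJ => ?_⟩
  · rw [Ideal.mem_comap, map_one] at h1
    exact (IsLocalRing.mem_maximalIdeal _).1 h1 isUnit_one
  · rw [Ideal.mem_comap, IsLocalRing.mem_maximalIdeal, mem_nonunits_iff, not_not] at hx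
    obtain ⟨y, hy⟩ := h x hx
    have h2 : x * y - 1 ∈ (IsLocalRing.maximalIdeal L).comap φ := by
      rw [Ideal.mem_comap, map_sub, map_mul, map_one, hy, sub_self]
      exact Ideal.zero_mem _
    have h3 := J.sub_mem (J.mul_mem_right y hxJ) (hJ h2)
    rwa [sub_sub_cancel] at h3

variable {S : Type u} [CommRing S] [Algebra R S]

/-- The map `φ : S → R_𝔮 / 𝔧` exhibits `R_𝔮 / 𝔧` as the localization of `S` at the maximal
ideal `n`. -/
structure IsLocalPiece (n : Ideal S) (A : AdmissibleInterval R) (φ : S →ₐ[R] LocQuot A.lo A.hi) :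
    Prop where
  isMaximal : n.IsMaximal
  notMem_iff : ∀ s, s ∉ n ↔ IsUnit (φ s)
  exists_mul_eq_zero : ∀ s, φ s = 0 → ∃ w ∉ n, w * s = 0

namespace IsLocalPiece

variable {n : Ideal S} {A : AdmissibleInterval R} {φ : S →ₐ[R] LocQuot A.lo A.hi}

theorem comap_eq (h : IsLocalPiece n A φ) : n.comap (algebraMap R S) = A.hi.asIdeal := by
  ext r
  rw [← not_iff_not, Ideal.mem_comap, h.notMem_iff, AlgHom.commutes,
    LocQuot.isUnit_algebraMap_iff A.le]

theorem exists_frac (h : IsLocalPiece n A φ) (s : S) :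
    ∃ w ∉ n, ∃ v : R, algebraMap R S v ∉ n ∧ ∃ b : R,
      w * (algebraMap R S v * s) = w * algebraMap R S b := by
  obtain ⟨b, v, hv, hb⟩ := LocQuot.exists_frac (φ s)
  obtain ⟨w, hw, hws⟩ := h.exists_mul_eq_zero (algebraMap R S v * s - algebraMap R S b) (by
    rw [map_sub, map_mul, AlgHom.commutes, AlgHom.commutes, hb, sub_self])
  refine ⟨w, hw, v, ?_, b, ?_⟩
  · rwa [h.notMem_iff, AlgHom.commutes, LocQuot.isUnit_algebraMap_iff A.le]
  · rwa [mul_sub, sub_eq_zero] at hws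

theorem isLocalization (h : IsLocalPiece n A φ) :
    @IsLocalization.AtPrime S _ (LocQuot A.lo A.hi) _ φ.toRingHom.toAlgebra n
      h.isMaximal.isPrime := by
  let _ := φ.toRingHom.toAlgebra
  have := h.isMaximal.isPrime
  refine (isLocalization_iff _ _).2 ⟨fun y => (h.notMem_iff y.1).1 y.2, fun z => ?_,
    fun {x y} hxy => ?_⟩
  · obtain ⟨b, v, hv, hb⟩ := LocQuot.exists_frac z
    have hv' : algebraMap R S v ∉ n := by
      rwa [h.notMem_iff, AlgHom.commutes, LocQuot.isUnit_algebraMap_iff A.le]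
    refine ⟨⟨algebraMap R S b, ⟨algebraMap R S v, hv'⟩⟩, ?_⟩
    change z * φ (algebraMap R S v) = φ (algebraMap R S b)
    rw [AlgHom.commutes, AlgHom.commutes, mul_comm, hb]
  · have hxy' : φ (x - y) = 0 := by
      rw [map_sub, sub_eq_zero]; exact hxy
    obtain ⟨w, hw, hws⟩ := h.exists_mul_eq_zero _ hxy'
    exact ⟨⟨w, hw⟩, by rwa [mul_sub, sub_eq_zero] at hws⟩

end IsLocalPiece

/-- Trades the abstract isomorphism of local rings for one algebra map out of `S`, the form used in
all later arguments. -/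
theorem mem_intervalsOf_iff {A : AdmissibleInterval R} :
    A ∈ intervalsOf (algebraMap R S) ↔ ∃ n φ, IsLocalPiece (S := S) n A φ := by
  constructor
  · rintro ⟨n, hn, hq, e, he⟩
    have := hn.isPrime
    let φ : S →ₐ[R] LocQuot A.lo A.hi :=
      { e.toRingHom.comp (algebraMap S (Localization.AtPrime n)) with commutes' := he }
    have hφ : ∀ s, φ s = e (algebraMap S (Localization.AtPrime n) s) := fun s => rfl
    refine ⟨n, φ, hn, fun s => ?_, fun s hs => ?_⟩
    · rw [hφ, MulEquiv.isUnit_map (f := e), IsLocalization.AtPrime.isUnit_to_map_iff _ n]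
      rfl
    · rw [hφ, map_eq_zero_iff e e.injective, IsLocalization.map_eq_zero_iff n.primeCompl] at hs
      obtain ⟨w, hw⟩ := hs
      exact ⟨w, w.2, hw⟩
  · rintro ⟨n, φ, h⟩
    let _ := φ.toRingHom.toAlgebra
    have hn := h.isMaximal.isPrime
    have hl : IsLocalization.AtPrime (LocQuot A.lo A.hi) n := h.isLocalization
    let e := IsLocalization.algEquiv n.primeCompl (Localization.AtPrime n) (LocQuot A.lo A.hi)
    refine ⟨n, h.isMaximal, h.comap_eq.symm, e.toRingEquiv, fun r => ?_⟩
    exact (e.commutes (algebraMap R S r)).trans (φ.commutes r)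

end LocQuot

/-! ### Order properties of closed chains -/

section Order

variable {R : Type u} [CommRing R] {I : Set (AdmissibleInterval R)}

theorem AdmissibleInterval.lt_iff {A B : AdmissibleInterval R} :
    A < B ↔ A.hi.asIdeal < B.lo.asIdeal := Iff.rfl

theorem lt_or_le_of_isChain (hI : IsChain (· ≤ ·) I) {A B : AdmissibleInterval R} (hA : A ∈ I)
    (hB : B ∈ I) : A < B ∨ B ≤ A := by
  rcases hI.total hA hB with h | h
  · rcases h.lt_or_eq with h | h
    · exact Or.inl h
    · exact Or.inr h.ge
  · exact Or.inr h

/-- `C` is the greatest element of `I` or has an immediate successor. -/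
def CutAbove (I : Set (AdmissibleInterval R)) (C : AdmissibleInterval R) : Prop :=
  (∀ B ∈ I, B ≤ C) ∨ ∃ D ∈ I, C < D ∧ ∀ B ∈ I, B ≤ C ∨ D ≤ B

/-- `D` is the least element of `I` or has an immediate predecessor. -/
def CutBelow (I : Set (AdmissibleInterval R)) (D : AdmissibleInterval R) : Prop :=
  (∀ B ∈ I, D ≤ B) ∨ ∃ C ∈ I, C < D ∧ ∀ B ∈ I, B ≤ C ∨ D ≤ B

namespace IsClosedChain

variable (hI : IsClosedChain I)
include hI

theorem lt_or_le {A B : AdmissibleInterval R} (hA : A ∈ I) (hB : B ∈ I) : A < B ∨ B ≤ A :=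
  lt_or_le_of_isChain hI.isChain hA hB

theorem exists_jump {A B : AdmissibleInterval R} (hA : A ∈ I) (hB : B ∈ I) (hAB : A < B) :
    ∃ C ∈ I, ∃ D ∈ I, A ≤ C ∧ C < D ∧ D ≤ B ∧ ∀ E ∈ I, E ≤ C ∨ D ≤ E := by
  obtain ⟨C, hC, D, hD, h1, h2, h3, h4⟩ := hI.c3 A hA B hB hAB
  refine ⟨C, hC, D, hD, h1, h2, h3, fun E hE => ?_⟩
  rcases hI.lt_or_le hC hE with h | h
  · rcases hI.lt_or_le hE hD with h' | h'
    · exact absurd ⟨E, hE, h, h'⟩ h4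
    · exact Or.inr h'
  · exact Or.inl h

/-- By (C2) closed chains have suprema. The last clause records how one arises: it is attained, or
its lower end is the union of the lower ends, so that membership in it is witnessed by an element of
`T`. -/
theorem exists_isLUB {T : Set (AdmissibleInterval R)} (hT : T ⊆ I) (hne : T.Nonempty) :
    ∃ K ∈ I, (∀ A ∈ T, A ≤ K) ∧ (∀ B ∈ I, (∀ A ∈ T, A ≤ B) → K ≤ B) ∧
      (K ∈ T ∨ (K.lo.asIdeal : Set R) = ⋃ A ∈ T, (A.lo.asIdeal : Set R)) := by
  by_cases h : ∃ A, Maximal (· ∈ T) A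
  · obtain ⟨K, hK⟩ := h
    refine ⟨K, hT hK.1, fun A hA => ?_, fun B _ h => h K hK.1, Or.inl hK.1⟩
    rcases hI.lt_or_le (hT hK.1) (hT hA) with h | h
    · exact hK.2 hA h.le
    · exact h
  · obtain ⟨K, hK, hKT⟩ := hI.c2 T hT hne h
    have hmem : ∀ x, x ∈ K.lo.asIdeal ↔ ∃ A ∈ T, x ∈ A.lo.asIdeal := fun x => by
      have := Set.ext_iff.1 hKT x
      simpa using this
    refine ⟨K, hK, fun A hA => ?_, fun B hB hAB => ?_, Or.inr hKT⟩
    · refine (hI.lt_or_le hK (hT hA)).resolve_left fun h => ?_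
      obtain ⟨x, hx, hx'⟩ := SetLike.exists_of_lt (AdmissibleInterval.lt_iff.1 h)
      exact hx' (K.le ((hmem x).2 ⟨A, hA, hx⟩))
    · refine (hI.lt_or_le hB hK).resolve_left fun h => ?_
      obtain ⟨x, hx, hx'⟩ := SetLike.exists_of_lt (AdmissibleInterval.lt_iff.1 h)
      obtain ⟨A, hA, hxA⟩ := (hmem x).1 hx
      exact hx' (B.le (AdmissibleInterval.lo_mono (hAB A hA) hxA))

theorem exists_isGLB {T : Set (AdmissibleInterval R)} (hT : T ⊆ I) (hne : T.Nonempty) :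
    ∃ K ∈ I, (∀ A ∈ T, K ≤ A) ∧ (∀ B ∈ I, (∀ A ∈ T, B ≤ A) → B ≤ K) ∧
      (K ∈ T ∨ (K.hi.asIdeal : Set R) = ⋂ A ∈ T, (A.hi.asIdeal : Set R)) := by
  by_cases h : ∃ A, Minimal (· ∈ T) A
  · obtain ⟨K, hK⟩ := h
    refine ⟨K, hT hK.1, fun A hA => ?_, fun B _ h => h K hK.1, Or.inl hK.1⟩
    rcases hI.lt_or_le (hT hA) (hT hK.1) with h | h
    · exact hK.2 hA h.le
    · exact h
  · obtain ⟨K, hK, hKT⟩ := hI.c1 T hT hne h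
    have hmem : ∀ x, x ∈ K.hi.asIdeal ↔ ∀ A ∈ T, x ∈ A.hi.asIdeal := fun x => by
      have := Set.ext_iff.1 hKT x
      simpa using this
    refine ⟨K, hK, fun A hA => ?_, fun B hB hAB => ?_, Or.inr hKT⟩
    · refine (hI.lt_or_le (hT hA) hK).resolve_left fun h => ?_
      obtain ⟨x, hx, hx'⟩ := SetLike.exists_of_lt (AdmissibleInterval.lt_iff.1 h)
      exact hx' ((hmem x).1 (K.le hx) A hA)
    · refine (hI.lt_or_le hK hB).resolve_left fun h => ?_
      obtain ⟨x, hx, hx'⟩ := SetLike.exists_of_lt (AdmissibleInterval.lt_iff.1 h)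
      exact hx' ((hmem x).2 fun A hA => AdmissibleInterval.hi_mono (hAB A hA) (B.le hx))

/-- The condition on `v` is open to the right. If `A` is neither greatest nor has a successor, it is
the infimum of the elements above it, so (C1) gives some `B > A` whose upper end also avoids `v`,
and (C3) supplies a jump between `A` and `B`. -/
theorem exists_cutAbove {A : AdmissibleInterval R} (hA : A ∈ I) {v : R} (hv : v ∉ A.hi.asIdeal) :
    ∃ C ∈ I, A ≤ C ∧ v ∉ C.hi.asIdeal ∧ CutAbove I C := by
  by_cases hne : ({B ∈ I | A < B} : Set (AdmissibleInterval R)).Nonempty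
  swap
  · refine ⟨A, hA, le_rfl, hv, Or.inl fun B hB => ?_⟩
    exact (hI.lt_or_le hA hB).resolve_left fun h => hne ⟨B, hB, h⟩
  obtain ⟨K, hK, h1, h2, h3⟩ := hI.exists_isGLB (T := {B ∈ I | A < B}) (fun B hB => hB.1) hne
  have hAK : A ≤ K := h2 A hA fun B hB => hB.2.le
  rcases hAK.lt_or_eq with h | rfl
  · refine ⟨A, hA, le_rfl, hv, Or.inr ⟨K, hK, h, fun B hB => ?_⟩⟩
    exact (hI.lt_or_le hA hB).symm.imp_right fun h => h1 B ⟨hB, h⟩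
  · have h4 := h3.resolve_left fun h => lt_irrefl _ h.2
    have h5 : v ∉ (A.hi.asIdeal : Set R) := hv
    rw [h4] at h5
    simp only [Set.mem_iInter, not_forall] at h5
    obtain ⟨B, hB, hvB⟩ := h5
    obtain ⟨C, hC, D, hD, h6, h7, h8, h9⟩ := hI.exists_jump hA hB.1 hB.2
    refine ⟨C, hC, h6, fun h => hvB ?_, Or.inr ⟨D, hD, h7, h9⟩⟩
    exact AdmissibleInterval.hi_mono (h7.le.trans h8) h

/-- Dual to `exists_cutAbove`: at a limit from below the lower end is a union, so `v` already lies
in an earlier lower end, and a jump can be found in between. -/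
theorem exists_cutBelow {A : AdmissibleInterval R} (hA : A ∈ I) {v : R} (hv : v ∈ A.lo.asIdeal) :
    ∃ D ∈ I, D ≤ A ∧ v ∈ D.lo.asIdeal ∧ CutBelow I D := by
  by_cases hne : ({B ∈ I | B < A} : Set (AdmissibleInterval R)).Nonempty
  swap
  · refine ⟨A, hA, le_rfl, hv, Or.inl fun B hB => ?_⟩
    exact (hI.lt_or_le hB hA).resolve_left fun h => hne ⟨B, hB, h⟩
  obtain ⟨K, hK, h1, h2, h3⟩ := hI.exists_isLUB (T := {B ∈ I | B < A}) (fun B hB => hB.1) hne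
  have hAK : K ≤ A := h2 A hA fun B hB => hB.2.le
  rcases hAK.lt_or_eq with h | rfl
  · refine ⟨A, hA, le_rfl, hv, Or.inr ⟨K, hK, h, fun B hB => ?_⟩⟩
    exact (hI.lt_or_le hB hA).imp_left fun h => h1 B ⟨hB, h⟩
  · have h4 := h3.resolve_left fun h => lt_irrefl _ h.2
    have h5 : v ∈ (K.lo.asIdeal : Set R) := hv
    rw [h4] at h5
    simp only [Set.mem_iUnion] at h5
    obtain ⟨B, hB, hvB⟩ := h5
    obtain ⟨C, hC, D, hD, h6, h7, h8, h9⟩ := hI.exists_jump hB.1 hK hB.2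
    refine ⟨D, hD, h8, ?_, Or.inr ⟨C, hC, h7, h9⟩⟩
    exact AdmissibleInterval.lo_mono (h6.trans h7.le) hvB

end IsClosedChain

end Order

/-! ### Partitions -/

namespace IntervalPartition

variable {R : Type u} [CommRing R] {I : Set (AdmissibleInterval R)} (P : IntervalPartition I)

theorem part_subset (l : Fin P.num) : P.part l ⊆ I :=
  (Set.subset_iUnion _ l).trans P.iUnion_part.subset

theorem part_unique {k l : Fin P.num} {A : AdmissibleInterval R} (hk : A ∈ P.part k)
    (hl : A ∈ P.part l) : k = l := by
  rcases lt_trichotomy k l with h | h | h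
  · exact absurd (P.lt_of_lt k l h A hk A hl) (lt_irrefl _)
  · exact h
  · exact absurd (P.lt_of_lt l k h A hl A hk) (lt_irrefl _)

theorem mem_part_iff {l : Fin P.num} {A : AdmissibleInterval R} :
    A ∈ P.part l ↔ A ∈ I ∧ P.bot l ≤ A ∧ A ≤ P.top l := by
  refine ⟨fun h => ⟨P.part_subset l h, (P.isLeast_bot l).2 h, (P.isGreatest_top l).2 h⟩, ?_⟩
  rintro ⟨hA, h1, h2⟩
  obtain ⟨k, hk⟩ := P.exists_mem_part ⟨A, hA⟩
  rcases lt_trichotomy k l with h | rfl | h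
  · exact absurd (P.lt_of_lt k l h A hk _ (P.isLeast_bot l).1) h1.not_gt
  · exact hk
  · exact absurd (P.lt_of_lt l k h _ (P.isGreatest_top l).1 A hk) h2.not_gt

/-- This describes the image without the product of rings: on each piece one fraction `a / v`, with
`v` invertible up to the top of the piece, represents all components. -/
theorem mem_range_toProd_iff {s : ProdRing I} : s ∈ P.toProd.range ↔
    ∀ l, ∃ a v : R, v ∉ (P.top l).hi.asIdeal ∧ ∀ A : I, A.1 ∈ P.part l →
      algebraMap R (LocQuot A.1.lo A.1.hi) v * s A = algebraMap R (LocQuot A.1.lo A.1.hi) a := by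
  constructor
  · rintro ⟨t, rfl⟩ l
    obtain ⟨a, v, hv, h⟩ := LocQuot.exists_frac (t l)
    refine ⟨a, v, hv, fun A hA => ?_⟩
    obtain rfl := P.part_unique (P.mem_part_index A) hA
    have := congrArg (LocQuot.map
      (AdmissibleInterval.lo_mono ((P.isLeast_bot _).2 (P.mem_part_index A)))
      (AdmissibleInterval.hi_mono ((P.isGreatest_top _).2 (P.mem_part_index A)))) h
    rw [map_mul, AlgHom.commutes, AlgHom.commutes] at this
    exact this
  · intro h
    choose a v hv h using h
    choose t ht using fun l => LocQuot.exists_mul_eq (j := (P.bot l).lo) (hv l)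
      (algebraMap R _ (a l))
    refine ⟨t, funext fun A => ?_⟩
    have hA := P.mem_part_index A
    have h1 := h _ A hA
    have h2 := congrArg (LocQuot.map
      (AdmissibleInterval.lo_mono ((P.isLeast_bot _).2 (P.mem_part_index A)))
      (AdmissibleInterval.hi_mono ((P.isGreatest_top _).2 (P.mem_part_index A)))) (ht (P.index A))
    rw [map_mul, AlgHom.commutes, AlgHom.commutes, ← h1] at h2
    have hv' : v (P.index A) ∉ A.1.hi.asIdeal := fun h' => hv _
      (AdmissibleInterval.hi_mono ((P.isGreatest_top _).2 hA) h')
    exact (LocQuot.isUnit_algebraMap hv').mul_left_cancel h2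

/-- A partition indexed by an arbitrary finite linear order. -/
theorem exists_of_linearOrder {ι : Type} [Fintype ι] [LinearOrder ι]
    (part : ι → Set (AdmissibleInterval R)) (h1 : ⋃ l, part l = I)
    (h2 : ∀ l, ∃ b, IsLeast (part l) b) (h3 : ∀ l, ∃ t, IsGreatest (part l) t)
    (h4 : ∀ k l, k < l → ∀ A ∈ part k, ∀ B ∈ part l, A < B) :
    ∃ W : IntervalPartition I, ∀ w, ∃ l, W.part w = part l := by
  choose b hb using h2
  choose t ht using h3
  let e := Fintype.orderIsoFinOfCardEq ι rfl
  refine ⟨{ num := Fintype.card ι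
            part := fun w => part (e w)
            iUnion_part := by rw [← h1]; exact e.surjective.iUnion_comp part
            bot := fun w => b (e w)
            top := fun w => t (e w)
            isLeast_bot := fun w => hb _
            isGreatest_top := fun w => ht _
            lt_of_lt := fun k l hkl => h4 _ _ (e.lt_iff_lt.2 hkl) }, fun w => ⟨e w, rfl⟩⟩

theorem range_le_of_forall_subset (W : IntervalPartition I)
    (h : ∀ w, ∃ l, W.part w ⊆ P.part l) : P.toProd.range ≤ W.toProd.range := by
  intro s hs
  rw [mem_range_toProd_iff] at hs ⊢
  intro w
  obtain ⟨l, hl⟩ := h w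
  obtain ⟨a, v, hv, hs⟩ := hs l
  refine ⟨a, v, fun h' => hv ?_, fun A hA => hs A (hl hA)⟩
  exact AdmissibleInterval.hi_mono ((P.isGreatest_top l).2 (hl (W.isGreatest_top w).1)) h'

theorem exists_refinement (hI : IsChain (· ≤ ·) I) (P Q : IntervalPartition I) :
    ∃ W : IntervalPartition I, P.toProd.range ≤ W.toProd.range ∧
      Q.toProd.range ≤ W.toProd.range := by
  classical
  -- Pairwise intersections in lexicographic order form the common refinement; empty ones are
  -- dropped, since pieces must have a least and a greatest element.
  let ι := {x : Fin P.num ×ₗ Fin Q.num //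
    (P.part (ofLex x).1 ∩ Q.part (ofLex x).2).Nonempty}
  have : Fintype (Fin P.num ×ₗ Fin Q.num) := inferInstanceAs (Fintype (Fin P.num × Fin Q.num))
  have : Fintype ι := inferInstanceAs (Fintype {x : Fin P.num ×ₗ Fin Q.num //
    (P.part (ofLex x).1 ∩ Q.part (ofLex x).2).Nonempty})
  obtain ⟨W, hW⟩ := exists_of_linearOrder (I := I) (ι := ι)
    (fun x => P.part (ofLex x.1).1 ∩ Q.part (ofLex x.1).2) (by
      refine Set.Subset.antisymm (Set.iUnion_subset fun x A hA => P.part_subset _ hA.1) ?_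
      intro A hA
      obtain ⟨k, hk⟩ := P.exists_mem_part ⟨A, hA⟩
      obtain ⟨l, hl⟩ := Q.exists_mem_part ⟨A, hA⟩
      exact Set.mem_iUnion.2 ⟨⟨toLex (k, l), A, hk, hl⟩, hk, hl⟩) (by
      rintro ⟨x, X, hX⟩
      have hP := P.mem_part_iff.1 hX.1
      have hQ := Q.mem_part_iff.1 hX.2
      have bP := P.isLeast_bot (ofLex x).1
      have bQ := Q.isLeast_bot (ofLex x).2
      rcases hI.total (P.part_subset _ bP.1) (Q.part_subset _ bQ.1) with h | h
      · exact ⟨_, ⟨P.mem_part_iff.2 ⟨Q.part_subset _ bQ.1, h, hQ.2.1.trans hP.2.2⟩, bQ.1⟩,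
          fun A hA => bQ.2 hA.2⟩
      · exact ⟨_, ⟨bP.1, Q.mem_part_iff.2 ⟨P.part_subset _ bP.1, h, hP.2.1.trans hQ.2.2⟩⟩,
          fun A hA => bP.2 hA.1⟩) (by
      rintro ⟨x, X, hX⟩
      have hP := P.mem_part_iff.1 hX.1
      have hQ := Q.mem_part_iff.1 hX.2
      have bP := P.isGreatest_top (ofLex x).1
      have bQ := Q.isGreatest_top (ofLex x).2
      rcases hI.total (P.part_subset _ bP.1) (Q.part_subset _ bQ.1) with h | h
      · exact ⟨_, ⟨bP.1, Q.mem_part_iff.2 ⟨P.part_subset _ bP.1, hQ.2.1.trans hP.2.2, h⟩⟩,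
          fun A hA => bP.2 hA.1⟩
      · exact ⟨_, ⟨P.mem_part_iff.2 ⟨Q.part_subset _ bQ.1, hP.2.1.trans hQ.2.2, h⟩, bQ.1⟩,
          fun A hA => bQ.2 hA.2⟩) (by
      rintro ⟨x, hx⟩ ⟨y, hy⟩ hxy A hA B hB
      rcases Prod.Lex.lt_iff.1 (show x < y from hxy) with h | ⟨-, h⟩
      · exact P.lt_of_lt _ _ h A hA.1 B hB.1
      · exact Q.lt_of_lt _ _ h A hA.2 B hB.2)
  refine ⟨W, P.range_le_of_forall_subset W fun w => ?_, Q.range_le_of_forall_subset W fun w => ?_⟩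
  · obtain ⟨x, hx⟩ := hW w
    exact ⟨(ofLex x.1).1, hx ▸ Set.inter_subset_left⟩
  · obtain ⟨x, hx⟩ := hW w
    exact ⟨(ofLex x.1).2, hx ▸ Set.inter_subset_right⟩

end IntervalPartition

/-! ### Elements of `R_(𝓘)` as piecewise fractions -/

section ChainRing

variable {R : Type u} [CommRing R] {I : Set (AdmissibleInterval R)}

theorem nonempty_intervalPartition (hI : IsClosedChain I) : Nonempty (IntervalPartition I) := by
  by_cases hne : I.Nonempty
  · obtain ⟨b, hb, hb', -⟩ := hI.exists_isGLB subset_rfl hne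
    obtain ⟨t, ht, ht', -⟩ := hI.exists_isLUB subset_rfl hne
    exact ⟨(IntervalPartition.exists_of_linearOrder (I := I) (ι := Fin 1) (fun _ => I)
      (Set.iUnion_const I) (fun _ => ⟨b, hb, hb'⟩) (fun _ => ⟨t, ht, ht'⟩)
      (fun k l h => absurd h (by omega))).choose⟩
  · rw [Set.not_nonempty_iff_eq_empty] at hne
    exact ⟨(IntervalPartition.exists_of_linearOrder (I := I) (ι := Fin 0) (fun _ => I)
      (by simp [hne]) (fun l => l.elim0) (fun l => l.elim0) (fun l => l.elim0)).choose⟩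

theorem mem_chainRing_iff (hI : IsClosedChain I) {s : ProdRing I} :
    s ∈ chainRing I ↔ ∃ P : IntervalPartition I, s ∈ P.toProd.range := by
  have := nonempty_intervalPartition hI
  have hd : Directed (· ≤ ·) fun P : IntervalPartition I => P.toProd.range :=
    fun P Q => IntervalPartition.exists_refinement hI.isChain P Q
  rw [chainRing, ← SetLike.mem_coe, Subalgebra.coe_iSup_of_directed hd, Set.mem_iUnion]
  rfl

/-- The element that is `a / v` on all elements of `I` that are at most `C`, and zero on all
others. -/
theorem exists_frac_of_cutAbove (hI : IsClosedChain I) {C : AdmissibleInterval R} (hC : C ∈ I)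
    (hcut : CutAbove I C) (a : R) {v : R} (hv : v ∉ C.hi.asIdeal) :
    ∃ y ∈ chainRing I, ∀ B : I,
      (B.1 ≤ C → algebraMap R (LocQuot B.1.lo B.1.hi) v * y B =
        algebraMap R (LocQuot B.1.lo B.1.hi) a) ∧ (¬ B.1 ≤ C → y B = 0) := by
  classical
  have hex : ∀ B : I, ∃ t : LocQuot B.1.lo B.1.hi,
      (B.1 ≤ C → algebraMap R (LocQuot B.1.lo B.1.hi) v * t =
        algebraMap R (LocQuot B.1.lo B.1.hi) a) ∧ (¬ B.1 ≤ C → t = 0) := fun B => by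
    by_cases h : B.1 ≤ C
    · obtain ⟨t, ht⟩ := LocQuot.exists_mul_eq (j := B.1.lo) (q := B.1.hi) (v := v)
        (fun h' => hv (AdmissibleInterval.hi_mono h h')) (algebraMap R _ a)
      exact ⟨t, fun _ => ht, fun h' => absurd h h'⟩
    · exact ⟨0, fun h' => absurd h' h, fun _ => rfl⟩
  choose y hy using hex
  refine ⟨y, (mem_chainRing_iff hI).2 ?_, hy⟩
  obtain ⟨b, hb, hb', -⟩ := hI.exists_isGLB subset_rfl ⟨C, hC⟩
  obtain ⟨t, ht, ht', -⟩ := hI.exists_isLUB subset_rfl ⟨C, hC⟩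
  rcases hcut with h | ⟨D, hD, hCD, hjump⟩
  · obtain ⟨W, hW⟩ := IntervalPartition.exists_of_linearOrder (I := I) (ι := Fin 1) (fun _ => I)
      (Set.iUnion_const I) (fun _ => ⟨b, hb, hb'⟩) (fun _ => ⟨t, ht, ht'⟩)
      (fun k l h => absurd h (by omega))
    refine ⟨W, W.mem_range_toProd_iff.2 fun w => ⟨a, v, fun h' => hv ?_, fun A _ => ?_⟩⟩
    · exact AdmissibleInterval.hi_mono (h _ (W.part_subset w (W.isGreatest_top w).1)) h'
    · exact (hy A).1 (h _ A.2)
  · have hDB : ∀ B, D ≤ B → ¬ B ≤ C := fun B h h' => (hCD.trans_le (h.trans h')).false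
    -- The jump from `C` to `D` splits `I` into two pieces; the element is `a / v` on the lower one
    -- and `0 / 1` on the upper one.
    obtain ⟨W, hW⟩ := IntervalPartition.exists_of_linearOrder (I := I) (ι := Fin 2)
      ![{B ∈ I | B ≤ C}, {B ∈ I | D ≤ B}] (by
        ext B
        simp only [Set.mem_iUnion, Fin.exists_fin_two, Matrix.cons_val_zero, Matrix.cons_val_one,
          Set.mem_ofPred_eq]
        exact ⟨fun h => h.elim (·.1) (·.1), fun h => (hjump B h).imp (⟨h, ·⟩) (⟨h, ·⟩)⟩)
      (by
        rw [Fin.forall_fin_two]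
        exact ⟨⟨b, ⟨hb, hb' C hC⟩, fun B hB => hb' B hB.1⟩, D, ⟨hD, le_rfl⟩, fun B hB => hB.2⟩)
      (by
        rw [Fin.forall_fin_two]
        exact ⟨⟨C, ⟨hC, le_rfl⟩, fun B hB => hB.2⟩, t, ⟨ht, ht' D hD⟩, fun B hB => ht' B hB.1⟩)
      (by
        rw [Fin.forall_fin_two]
        refine ⟨?_, fun l h => absurd h (by omega)⟩
        rw [Fin.forall_fin_two]
        exact ⟨fun h => absurd h (by omega),
          fun _ A hA B hB => (hA.2.trans_lt hCD).trans_le hB.2⟩)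
    refine ⟨W, W.mem_range_toProd_iff.2 fun w => ?_⟩
    obtain ⟨l, hl⟩ := hW w
    have hwt := (W.isGreatest_top w).1
    rw [hl] at hwt ⊢
    revert hwt
    revert l
    rw [Fin.forall_fin_two]
    refine ⟨fun _ hwt => ⟨a, v, fun h' => hv ?_, fun A hA => (hy A).1 hA.2⟩,
      fun _ hwt => ⟨0, 1, (W.top w).hi.2.one_notMem, fun A hA => ?_⟩⟩
    · exact AdmissibleInterval.hi_mono hwt.2 h'
    · rw [(hy A).2 (hDB _ hA.2), map_zero, mul_zero]

end ChainRing

/-! ### The ring `R_(𝓘)` of a closed chain -/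

theorem IsLocalPiece.interval_unique {R S : Type u} [CommRing R] [CommRing S] [Algebra R S]
    {n : Ideal S} {A B : AdmissibleInterval R} {φ : S →ₐ[R] LocQuot A.lo A.hi}
    {ψ : S →ₐ[R] LocQuot B.lo B.hi} (h : IsLocalPiece n A φ) (h' : IsLocalPiece n B ψ) :
    A = B := by
  -- The lower end is the kernel of `R` into the localization at `n`, so `n` alone determines it.
  have key : ∀ {A : AdmissibleInterval R} {φ : S →ₐ[R] LocQuot A.lo A.hi}, IsLocalPiece n A φ →
      ∀ x, x ∈ A.lo.asIdeal ↔ ∃ w ∉ n, w * algebraMap R S x = 0 := by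
    intro A φ h x
    rw [← LocQuot.algebraMap_eq_zero_iff A.le, ← φ.commutes]
    refine ⟨h.exists_mul_eq_zero _, ?_⟩
    rintro ⟨w, hw, hwx⟩
    have := congrArg φ hwx
    rw [map_mul, map_zero] at this
    exact ((h.notMem_iff w).1 hw).mul_right_eq_zero.1 this
  refine AdmissibleInterval.ext ?_ ?_
  · ext x
    rw [key h, key h']
  · ext x
    rw [← h.comap_eq, ← h'.comap_eq]

section ChainRing

variable {R : Type u} [CommRing R] {I : Set (AdmissibleInterval R)}

/-- The union of some of the pieces of a partition gives an element of `R_(𝓘)` that is `a / v` on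
these pieces and zero elsewhere. -/
theorem IntervalPartition.exists_frac (hI : IsClosedChain I) (P : IntervalPartition I)
    (U : Set (Fin P.num)) (a : R) {v : R} (hv : ∀ l ∈ U, v ∉ (P.top l).hi.asIdeal) :
    ∃ y ∈ chainRing I, ∀ (B : I) (k : Fin P.num), B.1 ∈ P.part k →
      (k ∈ U → algebraMap R (LocQuot B.1.lo B.1.hi) v * y B =
        algebraMap R (LocQuot B.1.lo B.1.hi) a) ∧ (k ∉ U → y B = 0) := by
  have hex : ∀ B : I, ∃ t : LocQuot B.1.lo B.1.hi,
      (P.index B ∈ U → algebraMap R (LocQuot B.1.lo B.1.hi) v * t =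
        algebraMap R (LocQuot B.1.lo B.1.hi) a) ∧ (P.index B ∉ U → t = 0) := fun B => by
    by_cases h : P.index B ∈ U
    · obtain ⟨t, ht⟩ := LocQuot.exists_mul_eq (j := B.1.lo) (q := B.1.hi) (v := v)
        (fun h' => hv _ h (AdmissibleInterval.hi_mono
          ((P.isGreatest_top _).2 (P.mem_part_index B)) h')) (algebraMap R _ a)
      exact ⟨t, fun _ => ht, fun h' => absurd h h'⟩
    · exact ⟨0, fun h' => absurd h' h, fun _ => rfl⟩
  choose y hy using hex
  have hy' : ∀ (B : I) (k : Fin P.num), B.1 ∈ P.part k →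
      (k ∈ U → algebraMap R (LocQuot B.1.lo B.1.hi) v * y B =
        algebraMap R (LocQuot B.1.lo B.1.hi) a) ∧ (k ∉ U → y B = 0) := fun B k hk => by
    obtain rfl := P.part_unique (P.mem_part_index B) hk
    exact hy B
  refine ⟨y, (mem_chainRing_iff hI).2 ⟨P, P.mem_range_toProd_iff.2 fun l => ?_⟩, hy'⟩
  by_cases h : l ∈ U
  · exact ⟨a, v, hv l h, fun A hA => (hy' A l hA).1 h⟩
  · exact ⟨0, 1, (P.top l).hi.2.one_notMem, fun A hA => by
      rw [(hy' A l hA).2 h, map_zero, mul_zero]⟩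

open Classical in
/-- The idempotent of `R_𝓘` supported on a set of intervals. -/
def indicator (I X : Set (AdmissibleInterval R)) : ProdRing I :=
  fun A => if A.1 ∈ X then 1 else 0

variable {X Y : Set (AdmissibleInterval R)}

theorem indicator_of_mem {A : I} (h : A.1 ∈ X) : indicator I X A = 1 := if_pos h

theorem indicator_of_notMem {A : I} (h : A.1 ∉ X) : indicator I X A = 0 := if_neg h

theorem eq_indicator {y : ProdRing I} (h1 : ∀ A : I, A.1 ∈ X → y A = 1)
    (h0 : ∀ A : I, A.1 ∉ X → y A = 0) : y = indicator I X := by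
  funext A
  by_cases h : A.1 ∈ X
  · rw [h1 A h, indicator_of_mem h]
  · rw [h0 A h, indicator_of_notMem h]

theorem IntervalPartition.indicator_mem (hI : IsClosedChain I) (P : IntervalPartition I)
    (U : Set (Fin P.num)) (hX : ∀ (A : I) (k : Fin P.num), A.1 ∈ P.part k → (A.1 ∈ X ↔ k ∈ U)) :
    indicator I X ∈ chainRing I := by
  obtain ⟨y, hy, h⟩ := P.exists_frac hI U 1 (v := 1) fun l _ => (P.top l).hi.2.one_notMem
  convert hy
  refine (eq_indicator (fun A hA => ?_) fun A hA => ?_).symm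
  · obtain ⟨k, hk⟩ := P.exists_mem_part A
    simpa using (h A k hk).1 ((hX A k hk).1 hA)
  · obtain ⟨k, hk⟩ := P.exists_mem_part A
    exact (h A k hk).2 fun h' => hA ((hX A k hk).2 h')

theorem IntervalPartition.indicator_part_mem (hI : IsClosedChain I) (P : IntervalPartition I)
    (l : Fin P.num) : indicator I (P.part l) ∈ chainRing I :=
  P.indicator_mem hI {l} fun _ _ hk =>
    ⟨fun h => P.part_unique hk h, fun h => by rw [Set.mem_singleton_iff] at h; rwa [← h]⟩

theorem indicator_Iic_mem (hI : IsClosedChain I) {C : AdmissibleInterval R} (hC : C ∈ I)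
    (hcut : CutAbove I C) : indicator I (Set.Iic C) ∈ chainRing I := by
  obtain ⟨y, hy, h⟩ := exists_frac_of_cutAbove hI hC hcut 1 (v := 1) C.hi.2.one_notMem
  convert hy
  refine (eq_indicator (fun A hA => ?_) fun A hA => (h A).2 hA).symm
  simpa using (h A).1 hA

theorem indicator_Ici_mem (hI : IsClosedChain I) {D : AdmissibleInterval R} (hD : D ∈ I)
    (hcut : CutBelow I D) : indicator I (Set.Ici D) ∈ chainRing I := by
  rcases hcut with h | ⟨C, hC, hCD, h⟩
  · rw [← eq_indicator (y := 1) (fun _ _ => rfl) fun A hA => absurd (h _ A.2) hA]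
    exact one_mem _
  · rw [← eq_indicator (y := 1 - indicator I (Set.Iic C)) (fun A hA => ?_) fun A hA => ?_]
    · exact sub_mem (one_mem _) (indicator_Iic_mem hI hC (Or.inr ⟨D, hD, hCD, h⟩))
    · rw [Pi.sub_apply, Pi.one_apply, indicator_of_notMem, sub_zero]
      exact fun h' => (hCD.trans_le (le_trans hA h')).false
    · rw [Pi.sub_apply, Pi.one_apply, indicator_of_mem, sub_self]
      exact (h _ A.2).resolve_right hA

/-- The projection of `R_(𝓘)` to a component. -/
def chainEval (I : Set (AdmissibleInterval R)) (A : I) :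
    chainRing I →ₐ[R] LocQuot A.1.lo A.1.hi :=
  (Pi.evalAlgHom R _ A).comp (chainRing I).val

theorem chainEval_apply (A : I) (s : chainRing I) : chainEval I A s = s.1 A := rfl

theorem chainEval_mk (A : I) {y : ProdRing I} (h : y ∈ chainRing I) :
    chainEval I A ⟨y, h⟩ = y A := rfl

theorem chainRing_ext {s t : chainRing I} (h : ∀ A, chainEval I A s = chainEval I A t) : s = t :=
  Subtype.ext (funext h)

/-- Two maps agreeing on `R` must first agree on the idempotents of a partition, then on fractions
supported on one piece. The target need not be commutative, as required for epimorphisms of rings.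
-/
theorem chainRing_ringHom_ext [IsDomain R] [ValuationRing R] (hI : IsClosedChain I) {T : Type*}
    [Ring T] {g h : chainRing I →+* T}
    (hR : ∀ r : R, g (algebraMap R (chainRing I) r) = h (algebraMap R (chainRing I) r)) :
    g = h := by
  ext s
  obtain ⟨P, hP⟩ := (mem_chainRing_iff hI).1 s.2
  let e : Fin P.num → chainRing I := fun l => ⟨_, P.indicator_part_mem hI l⟩
  have he1 : ∀ (l) (A : I), A.1 ∈ P.part l → chainEval I A (e l) = 1 :=
    fun l A hA => indicator_of_mem hA
  have he0 : ∀ (l) (A : I), A.1 ∉ P.part l → chainEval I A (e l) = 0 :=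
    fun l A hA => indicator_of_notMem hA
  have hfrac : ∀ (l) (v : R), v ∉ (P.top l).hi.asIdeal → ∃ y, algebraMap R _ v * y = e l ∧
      e l * y = y := by
    intro l v hv
    obtain ⟨y, hy, h⟩ := P.exists_frac hI {l} 1 (v := v) (by simpa using hv)
    refine ⟨⟨y, hy⟩, chainRing_ext fun A => ?_, chainRing_ext fun A => ?_⟩
    · by_cases hA : A.1 ∈ P.part l
      · rw [map_mul, AlgHom.commutes, he1 l A hA, chainEval_mk, (h A l hA).1 rfl, map_one]
      · obtain ⟨k, hk⟩ := P.exists_mem_part A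
        rw [map_mul, he0 l A hA, chainEval_mk A hy, (h A k hk).2, mul_zero]
        rintro rfl
        exact hA hk
    · by_cases hA : A.1 ∈ P.part l
      · rw [map_mul, he1 l A hA, one_mul]
      · obtain ⟨k, hk⟩ := P.exists_mem_part A
        rw [map_mul, he0 l A hA, zero_mul, chainEval_mk A hy, (h A k hk).2]
        rintro rfl
        exact hA hk
  have hkill : ∀ (l) (x : R), x ∈ (P.bot l).lo.asIdeal → algebraMap R _ x * e l = 0 := by
    intro l x hx
    refine chainRing_ext fun A => ?_
    by_cases hA : A.1 ∈ P.part l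
    · rw [map_mul, AlgHom.commutes, map_zero, (LocQuot.algebraMap_eq_zero_iff A.1.le).2, zero_mul]
      exact AdmissibleInterval.lo_mono ((P.isLeast_bot l).2 hA) hx
    · rw [map_mul, he0 l A hA, mul_zero, map_zero]
  have hsep : ∀ k l, k < l → ∃ x : R, x ∈ (P.bot l).lo.asIdeal ∧ x ∉ (P.top k).hi.asIdeal :=
    fun k l hkl => SetLike.exists_of_lt (AdmissibleInterval.lt_iff.1
      (P.lt_of_lt k l hkl _ (P.isGreatest_top k).1 _ (P.isLeast_bot l).1))
  -- An element `x` of `R` in the gap between the two pieces kills the upper idempotent and divides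
  -- the lower one. Moving `x` across the product, where `g` and `h` agree, makes the product zero.
  have horth : ∀ k l, k ≠ l → g (e k) * h (e l) = 0 := by
    intro k l hkl
    rcases lt_or_gt_of_ne hkl with hlt | hlt
    · obtain ⟨x, hx, hx'⟩ := hsep k l hlt
      obtain ⟨y, hy, -⟩ := hfrac k x hx'
      rw [← hy, mul_comm, map_mul, hR, mul_assoc, ← map_mul, hkill l x hx, map_zero, mul_zero]
    · obtain ⟨x, hx, hx'⟩ := hsep l k hlt
      obtain ⟨y, hy, -⟩ := hfrac l x hx'
      rw [← hy, map_mul, ← hR, ← mul_assoc, ← map_mul, mul_comm (e k), hkill k x hx, map_zero,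
        zero_mul]
  have hsum : ∑ l, e l = 1 := by
    refine chainRing_ext fun A => ?_
    obtain ⟨k, hk⟩ := P.exists_mem_part A
    rw [map_sum, map_one, Finset.sum_eq_single k, he1 k A hk]
    · intro l _ hlk
      exact he0 l A fun h => hlk (P.part_unique h hk)
    · simp
  have hge : ∀ l, g (e l) = h (e l) := by
    intro l
    have h1 : g (e l) = g (e l) * h (e l) := by
      conv_lhs => rw [← mul_one (g (e l)), ← map_one h, ← hsum, map_sum, Finset.mul_sum]
      exact Finset.sum_eq_single l (fun k _ hk => horth l k hk.symm) (by simp)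
    have h2 : h (e l) = g (e l) * h (e l) := by
      conv_lhs => rw [← one_mul (h (e l)), ← map_one g, ← hsum, map_sum, Finset.sum_mul]
      exact Finset.sum_eq_single l (fun k _ hk => horth k l hk) (by simp)
    rw [h1, ← h2]
  have hgs : ∀ l, g (s * e l) = h (s * e l) := by
    intro l
    obtain ⟨a, v, hv, hs⟩ := P.mem_range_toProd_iff.1 hP l
    obtain ⟨y, hy, hy'⟩ := hfrac l v hv
    -- Uniqueness of inverses in the corner cut out by `e l`, where `y` is the inverse of `v`.
    have hgy : g y = h y := by
      calc g y = g y * g (e l) := by rw [← map_mul, mul_comm, hy']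
        _ = g y * h (algebraMap R _ v * y) := by rw [hge, hy]
        _ = g (y * algebraMap R _ v) * h y := by rw [map_mul h, ← hR, ← mul_assoc, ← map_mul]
        _ = h (e l) * h y := by rw [mul_comm y, hy, hge]
        _ = h y := by rw [← map_mul, hy']
    have hse : s * e l = algebraMap R _ a * y := by
      refine chainRing_ext fun A => ?_
      by_cases hA : A.1 ∈ P.part l
      · have h1 := congrArg (chainEval I A) hy
        rw [map_mul, AlgHom.commutes, he1 l A hA] at h1
        rw [map_mul, map_mul, AlgHom.commutes, he1 l A hA, ← hs A hA, ← chainEval_apply]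
        linear_combination (-chainEval I A s) * h1
      · rw [← hy', map_mul, map_mul, map_mul, he0 l A hA]
        ring
    rw [hse, map_mul, map_mul, hgy, hR]
  rw [← mul_one s, ← hsum, Finset.mul_sum, map_sum, map_sum]
  exact Finset.sum_congr rfl fun l _ => hgs l

theorem epi_chainHom [IsDomain R] [ValuationRing R] (hI : IsClosedChain I) :
    Epi (RingCat.ofHom (S := chainRing I) (chainHom I)) :=
  ⟨fun _ _ hgh => RingCat.hom_ext (chainRing_ringHom_ext hI fun r =>
    congrArg (fun f => f.hom r) hgh)⟩

theorem isIdem_torsionOf_chainRing [IsDomain R] [ValuationRing R] (hI : IsClosedChain I)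
    (s : chainRing I) : IsIdem (Ideal.torsionOf R (chainRing I) s) := by
  obtain ⟨P, hP⟩ := (mem_chainRing_iff hI).1 s.2
  have hbot : ∀ l, P.bot l ∈ I := fun l => P.part_subset l (P.isLeast_bot l).1
  -- On a piece `s` is a single fraction, so vanishing at the bottom forces vanishing on the whole
  -- piece. The annihilator is therefore the lower end of the first bottom where `s` is nonzero, or
  -- `⊤` if there is none.
  have hiff : ∀ x : R, x • s = 0 ↔ ∀ l, x ∈ (P.bot l).lo.asIdeal ∨ s.1 ⟨_, hbot l⟩ = 0 := by
    intro x
    rw [Algebra.smul_def]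
    constructor
    · intro h l
      have h1 := congrArg (chainEval I ⟨_, hbot l⟩) h
      rw [map_mul, AlgHom.commutes, map_zero] at h1
      exact (LocQuot.algebraMap_mul_eq_zero (P.bot l).le).1 h1
    · intro h
      refine chainRing_ext fun A => ?_
      rw [map_mul, AlgHom.commutes, map_zero, LocQuot.algebraMap_mul_eq_zero A.1.le]
      obtain ⟨l, hl⟩ := P.exists_mem_part A
      have hlo := AdmissibleInterval.lo_mono ((P.isLeast_bot l).2 hl)
      refine (h l).imp (fun h => hlo h) fun h => ?_
      obtain ⟨a, v, hv, hs⟩ := P.mem_range_toProd_iff.1 hP l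
      have hv' : ∀ B ∈ P.part l, v ∉ B.hi.asIdeal := fun B hB h' =>
        hv (AdmissibleInterval.hi_mono ((P.isGreatest_top l).2 hB) h')
      have ha := (LocQuot.eq_zero_of_frac (P.bot l).le (hv' _ (P.isLeast_bot l).1)
        (hs ⟨_, hbot l⟩ (P.isLeast_bot l).1)).1 h
      exact (LocQuot.eq_zero_of_frac A.1.le (hv' _ hl) (hs A hl)).2 (hlo ha)
  classical
  let U : Finset (Fin P.num) := Finset.univ.filter fun l => s.1 ⟨_, hbot l⟩ ≠ 0
  have hU : ∀ l, l ∈ U ↔ s.1 ⟨_, hbot l⟩ ≠ 0 := fun l => by simp [U]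
  by_cases hne : U.Nonempty
  · have : Ideal.torsionOf R (chainRing I) s = (P.bot (U.min' hne)).lo.asIdeal := by
      ext x
      rw [Ideal.mem_torsionOf_iff, hiff]
      refine ⟨fun h => (h _).resolve_right ((hU _).1 (U.min'_mem hne)), fun h l => ?_⟩
      by_cases hl : s.1 ⟨_, hbot l⟩ = 0
      · exact Or.inr hl
      · left
        refine AdmissibleInterval.lo_mono ?_ h
        rcases (U.min'_le l ((hU l).2 hl)).lt_or_eq with h | h
        · exact (P.lt_of_lt _ _ h _ (P.isLeast_bot _).1 _ (P.isLeast_bot _).1).le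
        · rw [h]
    rw [this]
    exact isIdem_of_sq_eq (P.bot _).idem
  · have : Ideal.torsionOf R (chainRing I) s = ⊤ := by
      rw [Ideal.torsionOf_eq_top_iff, ← one_smul R s, hiff]
      refine fun l => Or.inr (by_contra fun h => hne ⟨l, (hU l).2 h⟩)
    rw [this]
    exact isIdem_top

theorem locQuot_isLocalRing (A : AdmissibleInterval R) : IsLocalRing (LocQuot A.lo A.hi) :=
  have := LocQuot.nontrivial A.le
  IsLocalRing.of_isUnit_or_isUnit_one_sub_self (LocQuot.isUnit_or_isUnit_one_sub A.le)

theorem exists_isLocalPiece_chainEval (hI : IsClosedChain I) (A : I) :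
    ∃ n : Ideal (chainRing I), IsLocalPiece (S := chainRing I) n A.1 (chainEval I A) := by
  have := locQuot_isLocalRing A.1
  let n := (IsLocalRing.maximalIdeal (LocQuot A.1.lo A.1.hi)).comap (chainEval I A)
  have hn : ∀ s, s ∉ n ↔ IsUnit (chainEval I A s) := fun s => by
    rw [Ideal.mem_comap, IsLocalRing.mem_maximalIdeal, mem_nonunits_iff, not_not]
  refine ⟨n, ?_, hn, fun s hs => ?_⟩
  · refine isMaximal_comap_maximalIdeal (S := chainRing I) (chainEval I A).toRingHom
      fun x hx => ?_
    change IsUnit (chainEval I A x) at hx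
    obtain ⟨a, v, hv, ha⟩ := LocQuot.exists_frac (chainEval I A x)
    have ha' := (LocQuot.isUnit_of_frac A.1.le hv ha).1 hx
    -- The inverse `v / a` at `A` extends to an element of `R_(𝓘)`, since `a` stays invertible up to
    -- a cut above `A`.
    obtain ⟨C, hC, hAC, haC, hcut⟩ := hI.exists_cutAbove A.2 ha'
    obtain ⟨y, hy, h⟩ := exists_frac_of_cutAbove hI hC hcut v haC
    have h1 := (h A).1 hAC
    refine ⟨⟨y, hy⟩, ?_⟩
    change chainEval I A x * chainEval I A ⟨y, hy⟩ = 1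
    have hu := LocQuot.isUnit_algebraMap (j := A.1.lo) ha'
    refine hu.mul_left_cancel ((LocQuot.isUnit_algebraMap (j := A.1.lo) hv).mul_left_cancel ?_)
    rw [chainEval_mk A hy]
    calc _ = (algebraMap R (LocQuot A.1.lo A.1.hi) v * chainEval I A x) *
          (algebraMap R (LocQuot A.1.lo A.1.hi) a * y A) := by ring
      _ = _ := by rw [ha, h1]; ring
  · obtain ⟨P, hP⟩ := (mem_chainRing_iff hI).1 s.2
    obtain ⟨l, hl⟩ := P.exists_mem_part A
    obtain ⟨a, v, hv, h⟩ := P.mem_range_toProd_iff.1 hP l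
    have hv' : ∀ B ∈ P.part l, v ∉ B.hi.asIdeal := fun B hB h' =>
      hv (AdmissibleInterval.hi_mono ((P.isGreatest_top l).2 hB) h')
    have ha := (LocQuot.eq_zero_of_frac A.1.le (hv' _ hl) (h A hl)).1 hs
    -- The numerator already vanishes from a cut `D ≤ A` on, so the idempotent of the piece
    -- restricted to the elements above `D` kills `s` and is `1` at `A`.
    obtain ⟨D, hD, hDA, haD, hcut⟩ := hI.exists_cutBelow A.2 ha
    refine ⟨⟨_, P.indicator_part_mem hI l⟩ * ⟨_, indicator_Ici_mem hI hD hcut⟩, ?_,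
      chainRing_ext fun B => ?_⟩
    · rw [hn, map_mul, chainEval_mk, chainEval_mk, indicator_of_mem hl,
        indicator_of_mem (X := Set.Ici D) hDA, mul_one]
      exact isUnit_one
    · rw [map_mul, map_mul, map_zero, chainEval_mk, chainEval_mk]
      by_cases hB : B.1 ∈ P.part l
      · by_cases hDB : D ≤ B.1
        · rw [chainEval_apply, (LocQuot.eq_zero_of_frac B.1.le (hv' _ hB) (h B hB)).2
            (AdmissibleInterval.lo_mono hDB haD), mul_zero]
        · rw [indicator_of_notMem (X := Set.Ici D) hDB, mul_zero, zero_mul]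
      · rw [indicator_of_notMem hB, zero_mul, zero_mul]

/-- Every maximal ideal of `R_(𝓘)` belongs to an element of `𝓘`. -/
theorem exists_isLocalPiece_of_isMaximal (hI : IsClosedChain I) (n : Ideal (chainRing I))
    (hn : n.IsMaximal) : ∃ A : I, IsLocalPiece (S := chainRing I) n A.1 (chainEval I A) := by
  suffices h : ∃ A : I, ∀ s ∈ n, ¬ IsUnit (chainEval I A s) by
    obtain ⟨A, hA⟩ := h
    obtain ⟨m, hm⟩ := exists_isLocalPiece_chainEval hI A
    have hnm : n = m := hn.eq_of_le hm.isMaximal.ne_top fun s hs => by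
      by_contra h
      exact hA s hs ((hm.notMem_iff s).1 h)
    exact ⟨A, hnm ▸ hm⟩
  have hnp := hn.isPrime
  have hne : I.Nonempty := by
    by_contra h
    rw [Set.not_nonempty_iff_eq_empty] at h
    subst h
    refine n.one_notMem ?_
    rw [show (1 : chainRing (∅ : Set (AdmissibleInterval R))) = 0 from
      chainRing_ext fun A => absurd A.2 (Set.notMem_empty _)]
    exact zero_mem _
  obtain ⟨b, hb, hb', -⟩ := hI.exists_isGLB subset_rfl hne
  obtain ⟨t, ht, ht', -⟩ := hI.exists_isLUB subset_rfl hne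
  -- The maximal ideal `n` acts as an ultrafilter on the cuts of `I`. `L` and `U` collect the lower
  -- and upper bounds of its limit point, and the supremum of `L` will be that point.
  let L : Set (AdmissibleInterval R) :=
    {D ∈ I | ∃ h : indicator I (Set.Ici D) ∈ chainRing I, ⟨_, h⟩ ∉ n}
  let U : Set (AdmissibleInterval R) :=
    {C ∈ I | ∃ h : indicator I (Set.Iic C) ∈ chainRing I, ⟨_, h⟩ ∉ n}
  have hLU : ∀ D ∈ L, ∀ C ∈ U, D ≤ C := by
    rintro D ⟨hD, hD1, hD2⟩ C ⟨hC, hC1, hC2⟩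
    refine (hI.lt_or_le hC hD).resolve_left fun hlt => ?_
    have h0 : (⟨_, hD1⟩ * ⟨_, hC1⟩ : chainRing I) = 0 := chainRing_ext fun A => by
      rw [map_mul, map_zero, chainEval_mk, chainEval_mk]
      by_cases h : A.1 ≤ C
      · rw [indicator_of_notMem (X := Set.Ici D), zero_mul]
        exact fun h' => (hlt.trans_le (le_trans h' h)).false
      · rw [indicator_of_notMem (X := Set.Iic C) h, mul_zero]
    have : (⟨_, hD1⟩ * ⟨_, hC1⟩ : chainRing I) ∈ n := h0 ▸ zero_mem _
    exact (hnp.mem_or_mem this).elim hD2 hC2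
  have hjump : ∀ C ∈ I, ∀ D ∈ I, C < D → (∀ E ∈ I, E ≤ C ∨ D ≤ E) → C ∈ U ∨ D ∈ L := by
    intro C hC D hD hCD h
    have hC1 := indicator_Iic_mem hI hC (Or.inr ⟨D, hD, hCD, h⟩)
    have hD1 := indicator_Ici_mem hI hD (Or.inr ⟨C, hC, hCD, h⟩)
    by_contra! hcon
    have hC2 : (⟨_, hC1⟩ : chainRing I) ∈ n := by
      by_contra h'; exact hcon.1 ⟨hC, hC1, h'⟩
    have hD2 : (⟨_, hD1⟩ : chainRing I) ∈ n := by
      by_contra h'; exact hcon.2 ⟨hD, hD1, h'⟩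
    refine n.one_notMem ?_
    have h1 := n.add_mem hC2 hD2
    refine (congrArg (· ∈ n) (chainRing_ext fun A => ?_)).mp h1
    rw [map_one, map_add, chainEval_mk, chainEval_mk]
    rcases h A.1 A.2 with h' | h'
    · rw [indicator_of_mem (X := Set.Iic C) h', indicator_of_notMem (X := Set.Ici D), add_zero]
      exact fun h'' => (hCD.trans_le (le_trans h'' h')).false
    · rw [indicator_of_mem (X := Set.Ici D) h', indicator_of_notMem (X := Set.Iic C), zero_add]
      exact fun h'' => (hCD.trans_le (le_trans h' h'')).false
  have hone : ∀ {X : Set (AdmissibleInterval R)}, I ⊆ X →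
      ∃ h : indicator I X ∈ chainRing I, ⟨_, h⟩ ∉ n := by
    intro X hX
    have h1 : indicator I X = 1 :=
      (eq_indicator (fun _ _ => rfl) fun A hA => absurd (hX A.2) hA).symm
    exact ⟨h1 ▸ one_mem _, fun h => n.one_notMem ((congrArg (· ∈ n) (Subtype.ext h1)).mp h)⟩
  have hbL : b ∈ L := ⟨hb, hone fun A hA => hb' A hA⟩
  have htU : t ∈ U := ⟨ht, hone fun A hA => ht' A hA⟩
  obtain ⟨K, hK, hK1, hK2, -⟩ := hI.exists_isLUB (T := L) (fun _ h => h.1) ⟨b, hbL⟩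
  have hKU : ∀ C ∈ U, K ≤ C := fun C hC => hK2 C hC.1 fun D hD => hLU D hD C hC
  refine ⟨⟨K, hK⟩, fun s hs hunit => ?_⟩
  obtain ⟨P, hP⟩ := (mem_chainRing_iff hI).1 s.2
  obtain ⟨l, hl⟩ : ∃ l, (⟨_, P.indicator_part_mem hI l⟩ : chainRing I) ∉ n := by
    by_contra! hcon
    have : ∑ l, (⟨_, P.indicator_part_mem hI l⟩ : chainRing I) = 1 := by
      refine chainRing_ext fun A => ?_
      obtain ⟨k, hk⟩ := P.exists_mem_part A
      rw [map_sum, map_one, Finset.sum_eq_single k]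
      · exact indicator_of_mem hk
      · intro l _ hlk
        exact indicator_of_notMem fun h => hlk (P.part_unique h hk)
      · simp
    exact n.one_notMem (this ▸ n.sum_mem fun l _ => hcon l)
  have hpart : ∀ X : Set (AdmissibleInterval R), P.part l ⊆ X →
      ∀ h : indicator I X ∈ chainRing I, (⟨_, h⟩ : chainRing I) ∉ n := by
    intro X hX h hmem
    refine hl ?_
    have h1 := n.mul_mem_right ⟨_, P.indicator_part_mem hI l⟩ hmem
    refine (congrArg (· ∈ n) (chainRing_ext fun A => ?_)).mp h1
    rw [map_mul, chainEval_mk, chainEval_mk]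
    by_cases hA : A.1 ∈ P.part l
    · rw [indicator_of_mem (hX hA), one_mul]
    · rw [indicator_of_notMem hA, mul_zero]
  have hKl : K ∈ P.part l := by
    refine P.mem_part_iff.2 ⟨hK, ?_, ?_⟩
    · have h1 := P.indicator_mem hI (X := Set.Ici (P.bot l)) (Set.Ici l) fun A k hk => by
        constructor
        · intro h
          by_contra h'
          rw [Set.mem_Ici, not_le] at h'
          exact ((P.lt_of_lt k l h' _ hk _ (P.isLeast_bot l).1).trans_le h).false
        · intro h
          rcases (show l ≤ k from h).lt_or_eq with h' | rfl
          · exact (P.lt_of_lt l k h' _ (P.isLeast_bot l).1 _ hk).le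
          · exact (P.isLeast_bot l).2 hk
      exact hK1 _ ⟨P.part_subset l (P.isLeast_bot l).1, h1,
        hpart _ (fun A hA => (P.isLeast_bot l).2 hA) h1⟩
    · have h1 := P.indicator_mem hI (X := Set.Iic (P.top l)) (Set.Iic l) fun A k hk => by
        constructor
        · intro h
          by_contra h'
          rw [Set.mem_Iic, not_le] at h'
          exact ((P.lt_of_lt l k h' _ (P.isGreatest_top l).1 _ hk).trans_le h).false
        · intro h
          rcases (show k ≤ l from h).lt_or_eq with h' | rfl
          · exact (P.lt_of_lt k l h' _ hk _ (P.isGreatest_top l).1).le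
          · exact (P.isGreatest_top k).2 hk
      exact hKU _ ⟨P.part_subset l (P.isGreatest_top l).1, h1,
        hpart _ (fun A hA => (P.isGreatest_top l).2 hA) h1⟩
  obtain ⟨a, v, hv, hav⟩ := P.mem_range_toProd_iff.1 hP l
  have hvK : v ∉ K.hi.asIdeal := fun h' =>
    hv (AdmissibleInterval.hi_mono ((P.isGreatest_top l).2 hKl) h')
  have ha := (LocQuot.isUnit_of_frac K.le hvK (hav ⟨K, hK⟩ hKl)).1 hunit
  obtain ⟨C, hC, hKC, haC, hcut⟩ := hI.exists_cutAbove hK ha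
  have hC1 := indicator_Iic_mem hI hC hcut
  -- Either `C` is greatest and the idempotent is `1`, or its successor lies strictly above the
  -- supremum `K` of `L`, and the jump then forces `C ∈ U`.
  have hC2 : (⟨_, hC1⟩ : chainRing I) ∉ n := by
    rcases hcut with h | ⟨D, hD, hCD, h⟩
    · exact (hone fun A hA => h A hA).2
    · rcases hjump C hC D hD hCD h with h' | h'
      · exact h'.2.2
      · exact absurd ((hK1 D h').trans hKC) hCD.not_ge
  obtain ⟨y, hy, hyB⟩ := exists_frac_of_cutAbove hI hC hcut 1 haC
  -- Multiplying `s = a / v` by `v / a`, cut off above `C` and outside the piece, yields an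
  -- idempotent in `n` although neither of its factors is.
  have hprod : (⟨_, P.indicator_part_mem hI l⟩ * ⟨_, hC1⟩ : chainRing I) ∈ n := by
    have h1 := n.mul_mem_right
      (algebraMap R _ v * ⟨_, P.indicator_part_mem hI l⟩ * (⟨y, hy⟩ : chainRing I)) hs
    refine (congrArg (· ∈ n) (chainRing_ext fun B => ?_)).mp h1
    rw [map_mul, map_mul, map_mul, map_mul, AlgHom.commutes, chainEval_mk, chainEval_mk, chainEval_mk,
      chainEval_mk]
    by_cases hB : B.1 ∈ P.part l
    · rw [indicator_of_mem hB]
      by_cases hBC : B.1 ≤ C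
      · rw [indicator_of_mem (X := Set.Iic C) hBC]
        have h1 := hav B hB
        have h2 := (hyB B).1 hBC
        rw [map_one] at h2
        linear_combination y B * h1 + h2
      · rw [indicator_of_notMem (X := Set.Iic C) hBC, (hyB B).2 hBC, mul_zero, mul_zero, mul_zero]
    · rw [indicator_of_notMem hB, zero_mul, mul_zero, zero_mul, mul_zero]
  exact (hnp.mem_or_mem hprod).elim hl hC2

theorem intervalsOf_chainHom (hI : IsClosedChain I) : intervalsOf (S := chainRing I) (chainHom I) = I := by
  ext A
  refine (mem_intervalsOf_iff (S := chainRing I)).trans ⟨?_, fun hA => ?_⟩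
  · rintro ⟨n, φ, h⟩
    obtain ⟨B, hB⟩ := exists_isLocalPiece_of_isMaximal hI n h.isMaximal
    rw [h.interval_unique hB]
    exact B.2
  · obtain ⟨n, hn⟩ := exists_isLocalPiece_chainEval hI ⟨A, hA⟩
    exact ⟨n, _, hn⟩

theorem isHomologicalEpi_chainHom [IsDomain R] [ValuationRing R] (hI : IsClosedChain I) :
    IsHomologicalEpi (S := chainRing I) (chainHom I) :=
  isHomologicalEpi_of_isIdem_torsionOf (S := chainRing I) (epi_chainHom hI) (isIdem_torsionOf_chainRing hI)
    fun n hn s => (exists_isLocalPiece_of_isMaximal hI n hn).choose_spec.exists_frac s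

end ChainRing

/-! ### The intervals of a homological epimorphism -/

section Intervals

variable {R S : Type u} [CommRing R] [CommRing S] [Algebra R S]

/-- The universal property of `R_𝔮 / 𝔧`. -/
def LocQuot.lift {j q : PrimeSpectrum R} {T : Type*} [CommRing T] [Algebra R T]
    (hj : ∀ x ∈ j.asIdeal, algebraMap R T x = 0)
    (hq : ∀ v ∉ q.asIdeal, IsUnit (algebraMap R T v)) : LocQuot j q →ₐ[R] T :=
  Ideal.Quotient.liftₐ _
    (IsLocalization.liftAlgHom (M := q.asIdeal.primeCompl) (f := Algebra.ofId R T)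
      fun y => hq y.1 y.2) (by
      intro a ha
      refine (RingHom.mem_ker (f := AlgHom.toRingHom _)).1 (Ideal.map_le_iff_le_comap.2 ?_ ha)
      intro x hx
      rw [Ideal.mem_comap, RingHom.mem_ker]
      exact (AlgHom.commutes _ x).trans (hj x hx))

variable [IsDomain R] [ValuationRing R]

/-- A homological epimorphism is locally of the form `R → R_𝔮 / 𝔧`. -/
theorem exists_isLocalPiece (he : CEpi (algebraMap R S))
    (hS : ∀ s : S, IsIdem (Ideal.torsionOf R S s)) (n : Ideal S) (hn : n.IsMaximal) :
    ∃ A φ, IsLocalPiece (R := R) n A φ := by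
  have hnp := hn.isPrime
  let T := Localization.AtPrime n
  have hRT : ∀ r : R, algebraMap R T r = algebraMap S T (algebraMap R S r) :=
    fun r => IsScalarTower.algebraMap_apply R S T r
  have hT : CEpi (algebraMap R T) := by
    rw [IsScalarTower.algebraMap_eq R S T]
    exact (cEpi_of_isLocalization n.primeCompl).comp he
  have hunit : ∀ s, IsUnit (algebraMap S T s) ↔ s ∉ n := fun s =>
    IsLocalization.AtPrime.isUnit_to_map_iff T n s
  let j : Ideal R := RingHom.ker (algebraMap R T)
  let q : Ideal R := n.comap (algebraMap R S)
  have hjmem : ∀ x, x ∈ j ↔ ∃ w ∉ n, w * algebraMap R S x = 0 := fun x => by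
    rw [RingHom.mem_ker, hRT, IsLocalization.map_eq_zero_iff n.primeCompl]
    exact ⟨fun ⟨w, hw⟩ => ⟨w, w.2, hw⟩, fun ⟨w, hw, h⟩ => ⟨⟨w, hw⟩, h⟩⟩
  -- The kernel is the union of the idempotent annihilators of elements outside `n`, so a
  -- factorization is found inside one of them.
  have hjidem : IsIdem j := by
    intro x hx
    obtain ⟨w, hw, hwx⟩ := (hjmem x).1 hx
    obtain ⟨y, hy, z, hz, rfl⟩ := hS w x (by
      rw [Ideal.mem_torsionOf_iff, Algebra.smul_def, mul_comm, hwx])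
    rw [Ideal.mem_torsionOf_iff, Algebra.smul_def, mul_comm] at hy hz
    exact ⟨y, (hjmem y).2 ⟨w, hw, hy⟩, z, (hjmem z).2 ⟨w, hw, hz⟩, rfl⟩
  have hjp : j.IsPrime := hjidem.isPrime (RingHom.ker_ne_top _)
  have hjq : j ≤ q := fun x hx => by
    obtain ⟨w, hw, hwx⟩ := (hjmem x).1 hx
    exact (hnp.mem_or_mem (hwx ▸ n.zero_mem : w * algebraMap R S x ∈ n)).resolve_left hw
  let A : AdmissibleInterval R :=
    { lo := ⟨j, hjp⟩, hi := ⟨q, inferInstance⟩, idem := hjidem.sq_eq, le := hjq }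
  have hjT : j.map (algebraMap R T) = ⊥ := (Ideal.map_eq_bot_iff_le_ker _).2 le_rfl
  obtain ⟨P, hP, hPj⟩ := (Ideal.comap_map_eq_self_iff_of_isPrime (f := algebraMap R T) j).1
    (by rw [hjT]; rfl)
  have hPmem : ∀ r, algebraMap R T r ∈ P ↔ r ∈ j := fun r => by rw [← hPj, Ideal.mem_comap]
  let ψ := Ideal.Quotient.mkₐ R P
  have hψ : ∀ t, ψ t = 0 ↔ t ∈ P := fun t => Ideal.Quotient.eq_zero_iff_mem
  have hψs : Function.Surjective ψ := Ideal.Quotient.mkₐ_surjective R P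
  let h : LocQuot A.lo A.hi →ₐ[R] T := LocQuot.lift (fun x hx => hx) fun v hv => by
    rw [hRT, hunit]; exact hv
  let k := ψ.comp h
  -- For surjectivity, the class of `t` modulo `P` is a fraction `r / v` because `jT = 0`. If `v`
  -- divides `r` it comes from `R`; otherwise it is `1 / c`, and `c ∉ q`, since else `ct` and `1 -
  -- ct` would both be nonunits of the local ring `T`.
  have hk : Function.Bijective k := by
    constructor
    · rw [injective_iff_map_eq_zero]
      intro t ht
      obtain ⟨a, v, hv, ha⟩ := LocQuot.exists_frac t
      have h1 := congrArg k ha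
      rw [map_mul, ht, mul_zero, AlgHom.commutes, ← ψ.commutes] at h1
      exact (LocQuot.eq_zero_of_frac A.le hv ha).2 ((hPmem a).1 ((hψ _).1 h1.symm))
    · intro d
      obtain ⟨t, rfl⟩ := hψs d
      obtain ⟨v, hv, r, hvr⟩ := hT.exists_mul_sub_mem_map j t
      rw [hjT, Ideal.mem_bot, sub_eq_zero] at hvr
      have hcancel : ∀ v ∉ j, ∀ d : T ⧸ P, algebraMap R (T ⧸ P) v * d = 0 → d = 0 := by
        intro v hv d hd
        refine (mul_eq_zero.1 hd).resolve_left fun h0 => hv ?_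
        rw [← ψ.commutes, hψ, hPmem] at h0
        exact h0
      have hvr' := congrArg ψ hvr
      rw [map_mul, AlgHom.commutes, AlgHom.commutes] at hvr'
      rcases ValuationRing.dvd_total v r with ⟨c, rfl⟩ | ⟨c, rfl⟩
      · refine ⟨algebraMap R _ c, ?_⟩
        rw [AlgHom.commutes]
        have := hcancel v hv (algebraMap R _ c - ψ t) (by rw [mul_sub, hvr', map_mul, sub_self])
        exact sub_eq_zero.1 this
      · have hr : r ∉ j := fun h => hv (j.mul_mem_right c h)
        have hct : algebraMap R _ c * ψ t = 1 := by
          have := hcancel r hr (algebraMap R _ c * ψ t - 1) (by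
            rw [mul_sub, ← mul_assoc, ← map_mul, hvr', mul_one, sub_self])
          exact sub_eq_zero.1 this
        have hc : c ∉ q := by
          intro hcq
          have h1 : ¬ IsUnit (algebraMap R T c * t) := fun hu => by
            have := isUnit_of_mul_isUnit_left hu
            rw [hRT, hunit] at this
            exact this hcq
          have h2 : 1 - algebraMap R T c * t ∈ P := by
            rw [← hψ, map_sub, map_one, map_mul, AlgHom.commutes, hct, sub_self]
          rcases IsLocalRing.isUnit_or_isUnit_one_sub_self (algebraMap R T c * t) with h3 | h3
          · exact h1 h3
          · exact hP.ne_top (Ideal.eq_top_of_isUnit_mem _ h2 h3)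
        obtain ⟨s, hs⟩ := LocQuot.exists_mul_eq (j := A.lo) (q := A.hi) hc 1
        refine ⟨s, ?_⟩
        have h1 := congrArg k hs
        rw [map_mul, map_one, AlgHom.commutes] at h1
        calc k s = k s * (algebraMap R _ c * ψ t) := by rw [hct, mul_one]
          _ = (algebraMap R _ c * k s) * ψ t := by ring
          _ = ψ t := by rw [h1, one_mul]
  let e := AlgEquiv.ofBijective k hk
  let g : T →ₐ[R] LocQuot A.lo A.hi := e.symm.toAlgHom.comp ψ
  have hgh : ∀ t, g (h t) = t := fun t => e.symm_apply_apply t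
  -- `g` is so far only a retraction of `h`; as `R → T` is an epimorphism, the endomorphism `h ∘ g`
  -- fixing `R` is the identity.
  have hhg : ∀ t, h (g t) = t := by
    have := hT T (h.comp g).toRingHom (RingHom.id T) (by
      ext r
      exact (h.comp g).commutes r)
    exact fun t => RingHom.congr_fun this t
  refine ⟨A, g.comp (IsScalarTower.toAlgHom R S T), hn, fun s => ?_, fun s hs => ?_⟩
  · rw [← hunit]
    exact ⟨fun hu => hu.map g, fun hu => by
      have := hu.map h
      rwa [AlgHom.comp_apply, hhg] at this⟩
  · have h1 : algebraMap S T s = 0 := by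
      rw [← hhg (algebraMap S T s)]
      exact (congrArg h hs).trans (map_zero h)
    obtain ⟨w, hw⟩ := (IsLocalization.map_eq_zero_iff n.primeCompl T s).1 h1
    exact ⟨w, w.2, hw⟩

omit [IsDomain R] [ValuationRing R] in
theorem eq_zero_of_algebraMap_mul_eq_zero {A : AdmissibleInterval R}
    {φ : S →ₐ[R] LocQuot A.lo A.hi} {x : R} {s : S}
    (h : algebraMap R S x * s = 0) : x ∈ A.lo.asIdeal ∨ φ s = 0 := by
  rw [← LocQuot.algebraMap_mul_eq_zero A.le, ← φ.commutes, ← map_mul, h, map_zero]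

theorem IsLocalPiece.exists_prime {n : Ideal S} {A : AdmissibleInterval R}
    {φ : S →ₐ[R] LocQuot A.lo A.hi} (h : IsLocalPiece n A φ) (p : Ideal R) [hp : p.IsPrime]
    (h1 : A.lo.asIdeal ≤ p) (h2 : p ≤ A.hi.asIdeal) :
    ∃ P : Ideal S, P.IsPrime ∧ P ≤ n ∧ P.comap (algebraMap R S) = p := by
  obtain ⟨Q, hQ, hQp⟩ := (Ideal.comap_map_eq_self_iff_of_isPrime
    (f := algebraMap R (LocQuot A.lo A.hi)) p).1 (by
      refine le_antisymm (fun r hr => ?_) Ideal.le_comap_map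
      obtain ⟨x, hx, s, hs⟩ := exists_mul_of_mem_map (Ideal.mem_comap.1 hr)
      obtain ⟨a, v, hv, ha⟩ := LocQuot.exists_frac s
      have h3 : v * r - x * a ∈ A.lo.asIdeal := by
        rw [← LocQuot.algebraMap_eq_zero_iff A.le, map_sub, map_mul, map_mul, ← ha, hs]
        ring
      have h4 := p.add_mem (h1 h3) (p.mul_mem_right a hx)
      rw [sub_add_cancel] at h4
      exact (hp.mem_or_mem h4).resolve_left fun h => hv (h2 h))
  refine ⟨Q.comap φ, inferInstance, fun s hs => ?_, ?_⟩
  · by_contra hsn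
    exact hQ.ne_top (Ideal.eq_top_of_isUnit_mem _ hs ((h.notMem_iff s).1 hsn))
  · ext r
    rw [Ideal.mem_comap, Ideal.mem_comap, AlgHom.commutes, ← hQp, Ideal.mem_comap]

/-- The smaller upper end is a prime inside the other interval, so it lifts to a prime of `S` below
the second maximal ideal. By injectivity on spectra this lift is the first maximal ideal, so the two
coincide. -/
theorem eq_of_overlap (he : CEpi (algebraMap R S)) {A B : AdmissibleInterval R}
    (hA : A ∈ intervalsOf (algebraMap R S)) (hB : B ∈ intervalsOf (algebraMap R S))
    (h1 : A.lo ≤ B.hi) (h2 : B.lo ≤ A.hi) : A = B := by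
  wlog h : A.hi.asIdeal ≤ B.hi.asIdeal generalizing A B
  · exact (this hB hA h2 h1 ((ideal_le_total _ _).resolve_left h)).symm
  obtain ⟨n, φ, hn⟩ := mem_intervalsOf_iff.1 hA
  obtain ⟨m, ψ, hm⟩ := mem_intervalsOf_iff.1 hB
  have := A.hi.2
  have := hn.isMaximal.isPrime
  obtain ⟨P, hP, hPm, hPA⟩ := hm.exists_prime A.hi.asIdeal h2 h
  have hPn : P = n := he.prime_eq_of_comap_eq (by rw [hPA, hn.comap_eq])
  subst hPn
  obtain rfl := hn.isMaximal.eq_of_le hm.isMaximal.ne_top hPm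
  exact hn.interval_unique hm

theorem isChain_intervalsOf (he : CEpi (algebraMap R S)) :
    IsChain (· ≤ ·) (intervalsOf (algebraMap R S)) := by
  intro A hA B hB hAB
  rcases ideal_lt_or_le A.hi.asIdeal B.lo.asIdeal with h | h
  · exact Or.inl (Or.inr h)
  · rcases ideal_lt_or_le B.hi.asIdeal A.lo.asIdeal with h' | h'
    · exact Or.inr (Or.inr h')
    · exact absurd (eq_of_overlap he hA hB h' h) hAB

/-- The last hypothesis says that `pS` contracts to `p`, so some prime of `S` lies over `p`; the
interval belongs to any maximal ideal above that prime. -/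
theorem exists_interval_of_prime (he : CEpi (algebraMap R S))
    (hS : ∀ s : S, IsIdem (Ideal.torsionOf R S s)) (p : Ideal R) [hp : p.IsPrime]
    (h : ∀ x ∈ p, ∀ (s : S) (r : R), algebraMap R S r = algebraMap R S x * s → r ∈ p) :
    ∃ K ∈ intervalsOf (algebraMap R S), K.lo.asIdeal ≤ p ∧ p ≤ K.hi.asIdeal := by
  obtain ⟨P, hP, hPp⟩ := (Ideal.comap_map_eq_self_iff_of_isPrime (f := algebraMap R S) p).1 (by
    refine le_antisymm (fun r hr => ?_) Ideal.le_comap_map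
    obtain ⟨x, hx, s, hs⟩ := exists_mul_of_mem_map (Ideal.mem_comap.1 hr)
    exact h x hx s r hs)
  obtain ⟨n, hn, hPn⟩ := Ideal.exists_le_maximal P hP.ne_top
  obtain ⟨K, φ, hK⟩ := exists_isLocalPiece he hS n hn
  refine ⟨K, mem_intervalsOf_iff.2 ⟨n, φ, hK⟩, fun x hx => ?_, fun x hx => ?_⟩
  · rw [← LocQuot.algebraMap_eq_zero_iff K.le, ← φ.commutes] at hx
    obtain ⟨w, hw, hwx⟩ := hK.exists_mul_eq_zero _ hx
    rw [← hPp, Ideal.mem_comap]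
    exact (hP.mem_or_mem (hwx ▸ P.zero_mem : w * algebraMap R S x ∈ P)).resolve_left
      fun h => hw (hPn h)
  · rw [← hK.comap_eq, Ideal.mem_comap]
    rw [← hPp] at hx
    exact hPn hx

omit [IsDomain R] [ValuationRing R] in
theorem mem_lo_of_algebraMap_eq_mul {A : AdmissibleInterval R}
    (hA : A ∈ intervalsOf (algebraMap R S)) {x r : R} {s : S} (hx : x ∈ A.lo.asIdeal)
    (h : algebraMap R S r = algebraMap R S x * s) : r ∈ A.lo.asIdeal := by
  obtain ⟨n, φ, hn⟩ := mem_intervalsOf_iff.1 hA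
  have := congrArg φ h
  rw [map_mul, AlgHom.commutes, AlgHom.commutes, (LocQuot.algebraMap_eq_zero_iff A.le).2 hx,
    zero_mul, LocQuot.algebraMap_eq_zero_iff A.le] at this
  exact this

theorem intervalsOf_c1 (he : CEpi (algebraMap R S))
    (hS : ∀ s : S, IsIdem (Ideal.torsionOf R S s)) (T : Set (AdmissibleInterval R))
    (hT : T ⊆ intervalsOf (algebraMap R S)) (hne : T.Nonempty)
    (hmin : ¬ ∃ A, Minimal (· ∈ T) A) :
    ∃ K ∈ intervalsOf (algebraMap R S),
      (K.hi.asIdeal : Set R) = ⋂ A ∈ T, (A.hi.asIdeal : Set R) := by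
  have hch := isChain_intervalsOf he
  let p : Ideal R := ⨅ A ∈ T, A.hi.asIdeal
  have hmem : ∀ x, x ∈ p ↔ ∀ A ∈ T, x ∈ A.hi.asIdeal := fun x => by
    simp only [p, Submodule.mem_iInf]
  have hp : p.IsPrime := by
    refine ⟨fun h => ?_, fun {a b} hab => ?_⟩
    · obtain ⟨A, hA⟩ := hne
      exact A.hi.2.one_notMem ((hmem 1).1 (h ▸ trivial) A hA)
    · by_contra! hcon
      rw [hmem, hmem] at hcon
      push Not at hcon
      obtain ⟨⟨A, hA, haA⟩, B, hB, hbB⟩ := hcon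
      rcases hch.total (hT hA) (hT hB) with h | h
      · exact (A.hi.2.mem_or_mem ((hmem _).1 hab A hA)).elim haA
          fun h' => hbB (AdmissibleInterval.hi_mono h h')
      · exact (B.hi.2.mem_or_mem ((hmem _).1 hab B hB)).elim
          (fun h' => haA (AdmissibleInterval.hi_mono h h')) hbB
  -- Without a minimal element the upper ends and the lower ends have the same intersection. Lower
  -- ends are kernels of maps to the local rings, which makes `p` contracted from `S`.
  have hlo : ∀ A ∈ T, p ≤ A.lo.asIdeal := by
    intro A hA
    by_contra h
    refine hmin ⟨A, hA, fun B hB hBA => ?_⟩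
    rcases hBA with rfl | hBA
    · exact le_rfl
    · exact absurd (fun x hx => hBA.le ((hmem x).1 hx B hB)) h
  obtain ⟨K, hK, h1, h2⟩ := exists_interval_of_prime he hS p fun x hx s r hr =>
    (hmem r).2 fun A hA => A.le (mem_lo_of_algebraMap_eq_mul (hT hA) (hlo A hA hx) hr)
  refine ⟨K, hK, ?_⟩
  ext x
  simp only [Set.mem_iInter, SetLike.mem_coe]
  rw [← hmem]
  refine ⟨fun hx => ?_, fun hx => h2 hx⟩
  rw [hmem]
  intro A hA
  by_contra hxA
  have hAK : A.hi.asIdeal ≤ K.hi.asIdeal :=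
    (ideal_le_total _ _).resolve_right fun h => hxA (h hx)
  obtain rfl := eq_of_overlap he (hT hA) hK (A.le.trans hAK) (h1.trans ((hlo A hA).trans A.le))
  exact hxA hx

/-- The union `p` of the lower ends is contracted from `S`, so it lies in some interval `K`; a lower
end not contained in that of `K` would make its interval overlap `K` and hence equal it. -/
theorem intervalsOf_c2 (he : CEpi (algebraMap R S))
    (hS : ∀ s : S, IsIdem (Ideal.torsionOf R S s)) (T : Set (AdmissibleInterval R))
    (hT : T ⊆ intervalsOf (algebraMap R S)) (hne : T.Nonempty) :
    ∃ K ∈ intervalsOf (algebraMap R S),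
      (K.lo.asIdeal : Set R) = ⋃ A ∈ T, (A.lo.asIdeal : Set R) := by
  have hch := isChain_intervalsOf he
  have hadd : ∀ {a b : R}, (∃ A ∈ T, a ∈ A.lo.asIdeal) → (∃ A ∈ T, b ∈ A.lo.asIdeal) →
      ∃ A ∈ T, a + b ∈ A.lo.asIdeal := by
    rintro a b ⟨A, hA, ha⟩ ⟨B, hB, hb⟩
    rcases hch.total (hT hA) (hT hB) with h | h
    · exact ⟨B, hB, add_mem (AdmissibleInterval.lo_mono h ha) hb⟩
    · exact ⟨A, hA, add_mem ha (AdmissibleInterval.lo_mono h hb)⟩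
  let p : Ideal R :=
    { carrier := {x | ∃ A ∈ T, x ∈ A.lo.asIdeal}
      add_mem' := hadd
      zero_mem' := ⟨hne.some, hne.some_mem, zero_mem _⟩
      smul_mem' := fun c x ⟨A, hA, hx⟩ => ⟨A, hA, Ideal.mul_mem_left _ c hx⟩ }
  have hmem : ∀ x, x ∈ p ↔ ∃ A ∈ T, x ∈ A.lo.asIdeal := fun x => Iff.rfl
  have hp : p.IsPrime := by
    refine ⟨fun h => ?_, ?_⟩
    · obtain ⟨A, hA, h1⟩ := (hmem 1).1 (h ▸ trivial)
      exact A.lo.2.one_notMem h1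
    · rintro a b ⟨A, hA, hab⟩
      exact (A.lo.2.mem_or_mem hab).imp (fun h => ⟨A, hA, h⟩) fun h => ⟨A, hA, h⟩
  obtain ⟨K, hK, h1, h2⟩ := exists_interval_of_prime he hS p (by
    rintro x ⟨A, hA, hx⟩ s r hr
    exact ⟨A, hA, mem_lo_of_algebraMap_eq_mul (hT hA) hx hr⟩)
  refine ⟨K, hK, ?_⟩
  ext x
  simp only [Set.mem_iUnion, SetLike.mem_coe, exists_prop]
  rw [← hmem]
  refine ⟨fun hx => h1 hx, ?_⟩
  rintro ⟨A, hA, hx⟩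
  by_contra hxK
  have hKA : K.lo.asIdeal ≤ A.lo.asIdeal :=
    (ideal_le_total _ _).resolve_right fun h => hxK (h hx)
  obtain rfl := eq_of_overlap he (hT hA) hK (fun y hy => h2 ⟨A, hA, hy⟩) (hKA.trans A.le)
  exact hxK hx

theorem intervalsOf_c3 (he : CEpi (algebraMap R S))
    (hS : ∀ s : S, IsIdem (Ideal.torsionOf R S s)) {A B : AdmissibleInterval R}
    (hA : A ∈ intervalsOf (algebraMap R S)) (hB : B ∈ intervalsOf (algebraMap R S))
    (hAB : A < B) :
    ∃ C ∈ intervalsOf (algebraMap R S), ∃ D ∈ intervalsOf (algebraMap R S),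
      A ≤ C ∧ C < D ∧ D ≤ B ∧ ¬ ∃ E ∈ intervalsOf (algebraMap R S), C < E ∧ E < D := by
  set I := intervalsOf (algebraMap R S) with hI
  have hch : IsChain (· ≤ ·) I := isChain_intervalsOf he
  by_contra! hno
  obtain ⟨x, hxB, hxA⟩ := SetLike.exists_of_lt (AdmissibleInterval.lt_iff.1 hAB)
  obtain ⟨m, φB, hm⟩ := mem_intervalsOf_iff.1 hB
  obtain ⟨w, hw, hwx⟩ := hm.exists_mul_eq_zero (algebraMap R S x) (by
    rw [AlgHom.commutes, LocQuot.algebraMap_eq_zero_iff B.le]; exact hxB)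
  -- The element `w` is invertible at `B` but killed by `x`, which is nonzero at `A`. Its
  -- annihilator is an idempotent prime strictly above `A.hi` and inside `B.lo`: the place where `w`
  -- switches from zero to nonzero.
  let p := Ideal.torsionOf R S w
  have hpmem : ∀ y, y ∈ p ↔ algebraMap R S y * w = 0 := fun y => by
    rw [Ideal.mem_torsionOf_iff, Algebra.smul_def]
  have hp : p.IsPrime := (hS w).isPrime (by
    rw [Ne, Ideal.torsionOf_eq_top_iff]
    rintro rfl
    exact hw (zero_mem _))
  have hxp : x ∈ p := by rw [hpmem, mul_comm, hwx]
  have hpB : p ≤ B.lo.asIdeal := fun y hy =>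
    (eq_zero_of_algebraMap_mul_eq_zero (φ := φB) ((hpmem y).1 hy)).resolve_right
      fun h0 => by
        have := (hm.notMem_iff w).1 hw
        rw [h0] at this
        have := LocQuot.nontrivial B.le
        exact not_isUnit_zero ‹_›
  have hAp : A.hi.asIdeal < p := (ideal_lt_or_le _ _).resolve_right fun h => hxA (h hxp)
  obtain ⟨K, hK, hKp, hpK⟩ := exists_interval_of_prime he hS p fun y hy s r hr => by
    rw [hpmem, hr, mul_right_comm, (hpmem y).1 hy, zero_mul]
  obtain ⟨v, hv, r, hvr⟩ := he.exists_mul_sub_mem_map p w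
  -- If `r ∈ p`, then `vw = yt` with `y ∈ p`, so `y²` kills `t`. The annihilator of `t` is prime or
  -- everything, so `y` kills `t` and `v` kills `w`, against `v ∉ p`.
  have hr : r ∉ p := by
    intro hr
    have h1 := Ideal.add_mem _ hvr (Ideal.mem_map_of_mem _ hr)
    rw [sub_add_cancel] at h1
    obtain ⟨y, hy, t, ht⟩ := exists_mul_of_mem_map h1
    have hyt : y ∈ Ideal.torsionOf R S t := by
      have h2 : y * y ∈ Ideal.torsionOf R S t := by
        rw [Ideal.mem_torsionOf_iff, Algebra.smul_def, map_mul, mul_assoc, ← ht, mul_left_comm,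
          (hpmem y).1 hy, mul_zero]
      by_cases htop : Ideal.torsionOf R S t = ⊤
      · rw [htop]; trivial
      · exact (or_self_iff).1 (((hS t).isPrime htop).mem_or_mem h2)
    rw [Ideal.mem_torsionOf_iff, Algebra.smul_def] at hyt
    exact hv ((hpmem v).2 (by rw [ht, hyt]))
  obtain ⟨y, hy, t, ht⟩ := exists_mul_of_mem_map hvr
  -- At every interval where `w` vanishes the congruence `vw ≡ r` modulo `pS` becomes `r + yt = 0`;
  -- the contradiction comes from finding such an interval where this forces `r ∈ p`.
  have heval : ∀ (E : AdmissibleInterval R) (φ : S →ₐ[R] LocQuot E.lo E.hi),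
      ¬ p ≤ E.lo.asIdeal →
      algebraMap R (LocQuot E.lo E.hi) r + algebraMap R (LocQuot E.lo E.hi) y * φ t = 0 := by
    intro E φ hpE
    obtain ⟨z, hz, hzE⟩ := SetLike.not_le_iff_exists.1 hpE
    have h0 : φ w = 0 := (eq_zero_of_algebraMap_mul_eq_zero (φ := φ)
      ((hpmem z).1 hz)).resolve_left hzE
    have h1 := congrArg φ ht
    rw [map_sub, map_mul, map_mul, h0, AlgHom.commutes, AlgHom.commutes, mul_zero, zero_sub] at h1
    rw [AlgHom.commutes] at h1
    rw [← h1, add_neg_cancel]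
  rcases hKp.lt_or_eq with hlt | heq
  · obtain ⟨n, φ, hn⟩ := mem_intervalsOf_iff.1 hK
    have h1 := heval K φ hlt.not_ge
    obtain ⟨b, c, hc, hbc⟩ := LocQuot.exists_frac (φ t)
    have h2 : c * r + y * b ∈ K.lo.asIdeal := by
      rw [← LocQuot.algebraMap_eq_zero_iff K.le, map_add, map_mul, map_mul, ← hbc]
      linear_combination algebraMap R (LocQuot K.lo K.hi) c * h1
    have h3 := p.sub_mem (hKp h2) (p.mul_mem_right b hy)
    rw [add_sub_cancel_right] at h3
    exact (hp.mem_or_mem h3).elim (fun h => hc (hpK h)) hr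
  · have hAK : A < K := by rw [AdmissibleInterval.lt_iff, heq]; exact hAp
    have hKB : K ≤ B := (lt_or_le_of_isChain hch hB hK).resolve_left fun h => by
      rw [AdmissibleInterval.lt_iff, heq] at h
      exact (h.trans_le (hpB.trans B.le)).false
    -- Without jumps `K` is the supremum of the elements below it, so `p = K.lo` is a union of
    -- earlier lower ends. Then `y` vanishes at some earlier `E`, hence so does `r`.
    let T : Set (AdmissibleInterval R) := {E ∈ I | A ≤ E ∧ E < K}
    have hATmem : A ∈ T := ⟨hA, le_rfl, hAK⟩
    have hnomax : ∀ C ∈ T, ∃ E ∈ T, C < E := by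
      rintro C ⟨hC, hAC, hCK⟩
      obtain ⟨E, hE, hCE, hEK⟩ := hno C hC K hK hAC hCK hKB
      exact ⟨E, ⟨hE, hAC.trans hCE.le, hEK⟩, hCE⟩
    obtain ⟨L, hL, hLT⟩ := intervalsOf_c2 he hS T (fun E hE => hE.1) ⟨A, hATmem⟩
    have hLmem : ∀ z, z ∈ L.lo.asIdeal ↔ ∃ E ∈ T, z ∈ E.lo.asIdeal := fun z => by
      have := Set.ext_iff.1 hLT z
      simpa using this
    have hTL : ∀ E ∈ T, E.lo.asIdeal ≤ L.lo.asIdeal := fun E hE z hz => (hLmem z).2 ⟨E, hE, hz⟩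
    have hLK : L = K := by
      have h1 : L ≤ K := (lt_or_le_of_isChain hch hK hL).resolve_left fun h => by
        obtain ⟨z, hz, hzK⟩ := SetLike.exists_of_lt (AdmissibleInterval.lt_iff.1 h)
        obtain ⟨E, hE, hzE⟩ := (hLmem z).1 hz
        exact hzK (K.le (AdmissibleInterval.lo_mono hE.2.2.le hzE))
      have h2 : A ≤ L := (lt_or_le_of_isChain hch hL hA).resolve_left fun h =>
        ((AdmissibleInterval.lt_iff.1 h).trans_le ((hTL A hATmem).trans L.le)).false
      refine h1.eq_of_not_lt fun h3 => ?_
      obtain ⟨E, hE, hLE⟩ := hnomax L ⟨hL, h2, h3⟩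
      exact ((AdmissibleInterval.lt_iff.1 hLE).trans_le ((hTL E hE).trans L.le)).false
    rw [← heq, ← hLK] at hy
    obtain ⟨E, hE, hyE⟩ := (hLmem y).1 hy
    obtain ⟨n, φ, hn⟩ := mem_intervalsOf_iff.1 hE.1
    have hEp : E.hi.asIdeal < p := by
      have := AdmissibleInterval.lt_iff.1 hE.2.2
      rwa [heq] at this
    have h1 := heval E φ fun h => (hEp.trans_le (h.trans E.le)).false
    rw [(LocQuot.algebraMap_eq_zero_iff E.le).2 hyE, zero_mul, add_zero,
      LocQuot.algebraMap_eq_zero_iff E.le] at h1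
    exact hr (hEp.le (E.le h1))

theorem isClosedChain_intervalsOf (he : CEpi (algebraMap R S))
    (hS : ∀ s : S, IsIdem (Ideal.torsionOf R S s)) :
    IsClosedChain (intervalsOf (algebraMap R S)) where
  isChain := isChain_intervalsOf he
  c1 := intervalsOf_c1 he hS
  c2 := fun T hT hne _ => intervalsOf_c2 he hS T hT hne
  c3 := fun _ hA _ hB hAB => intervalsOf_c3 he hS hA hB hAB

end Intervals

/-! ### Reconstruction of a homological epimorphism from its intervals -/

section Reconstruction

variable {R S : Type u} [CommRing R] [CommRing S] [Algebra R S] {I : Set (AdmissibleInterval R)}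

/-- The `R`-algebra `S` has local pieces indexed by `I`, at all of its maximal ideals. -/
structure HasPieces (I : Set (AdmissibleInterval R)) (S : Type u) [CommRing S] [Algebra R S]
    (n : I → Ideal S) (φ : ∀ A : I, S →ₐ[R] LocQuot A.1.lo A.1.hi) : Prop where
  piece : ∀ A, IsLocalPiece (n A) A.1 (φ A)
  exists_eq : ∀ m : Ideal S, m.IsMaximal → ∃ A, m = n A

namespace HasPieces

variable {n : I → Ideal S} {φ : ∀ A : I, S →ₐ[R] LocQuot A.1.lo A.1.hi} (h : HasPieces I S n φ)
include h

theorem eq_top_of_forall (J : Ideal S) (hJ : ∀ A, ∃ s ∈ J, IsUnit (φ A s)) : J = ⊤ := by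
  by_contra hne
  obtain ⟨m, hm, hJm⟩ := Ideal.exists_le_maximal J hne
  obtain ⟨A, rfl⟩ := h.exists_eq m hm
  obtain ⟨s, hs, hu⟩ := hJ A
  exact ((h.piece A).notMem_iff s).2 hu (hJm hs)

theorem isUnit_of_forall (s : S) (hs : ∀ A, IsUnit (φ A s)) : IsUnit s :=
  Ideal.span_singleton_eq_top.1
    (h.eq_top_of_forall _ fun A => ⟨s, Ideal.mem_span_singleton_self s, hs A⟩)

theorem eq_zero_of_forall (s : S) (hs : ∀ A, φ A s = 0) : s = 0 := by
  have := h.eq_top_of_forall (Ideal.torsionOf S S s) fun A => by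
    obtain ⟨w, hw, hws⟩ := (h.piece A).exists_mul_eq_zero s (hs A)
    exact ⟨w, (Ideal.mem_torsionOf_iff _ _).2 hws, ((h.piece A).notMem_iff w).1 hw⟩
  rwa [Ideal.torsionOf_eq_top_iff] at this

theorem injective : Function.Injective (AlgHom.pi φ) := by
  rw [injective_iff_map_eq_zero]
  exact fun s hs => h.eq_zero_of_forall s fun A => congrFun hs A

/-- An element of `R` that is invertible on one part of `I` and zero on the rest gives rise to an
idempotent. -/
theorem exists_indicator (X : Set (AdmissibleInterval R)) (x : R)
    (h1 : ∀ A ∈ I, A ∈ X → x ∉ A.hi.asIdeal) (h2 : ∀ A ∈ I, A ∉ X → x ∈ A.lo.asIdeal) :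
    ∃ e : S, AlgHom.pi φ e = indicator I X := by
  have hx0 : ∀ A : I, A.1 ∉ X → φ A (algebraMap R S x) = 0 := fun A hA => by
    rw [AlgHom.commutes, LocQuot.algebraMap_eq_zero_iff A.1.le]; exact h2 _ A.2 hA
  have hx1 : ∀ A : I, A.1 ∈ X → IsUnit (φ A (algebraMap R S x)) := fun A hA => by
    rw [AlgHom.commutes]; exact LocQuot.isUnit_algebraMap (h1 _ A.2 hA)
  -- `J` is the ideal of those `s` with `xs ∈ (x²)`. Locally `x` is a unit or zero, so `J = S` and
  -- `x = yx²`; the idempotent is `yx`.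
  let J : Ideal S := Submodule.comap (LinearMap.mulLeft S (algebraMap R S x))
    (Ideal.span {algebraMap R S x * algebraMap R S x})
  have hJ : J = ⊤ := h.eq_top_of_forall J fun A => by
    by_cases hA : A.1 ∈ X
    · exact ⟨algebraMap R S x, Ideal.mem_span_singleton_self _, hx1 A hA⟩
    · obtain ⟨w, hw, hwx⟩ := (h.piece A).exists_mul_eq_zero _ (hx0 A hA)
      refine ⟨w, ?_, ((h.piece A).notMem_iff w).1 hw⟩
      change algebraMap R S x * w ∈ Ideal.span {algebraMap R S x * algebraMap R S x}
      rw [mul_comm _ w, hwx]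
      exact zero_mem _
  have h1J : (1 : S) ∈ J := hJ ▸ trivial
  obtain ⟨y, hy⟩ := Ideal.mem_span_singleton'.1 (show algebraMap R S x * 1 ∈
    Ideal.span {algebraMap R S x * algebraMap R S x} from h1J)
  refine ⟨y * algebraMap R S x, eq_indicator (fun A hA => ?_) fun A hA => ?_⟩
  · change φ A _ = 1
    have h3 := congrArg (φ A) hy
    rw [mul_one, ← mul_assoc, map_mul] at h3
    exact (hx1 A hA).mul_right_cancel (h3.trans (one_mul _).symm)
  · change φ A _ = 0
    rw [map_mul, hx0 A hA, mul_zero]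

/-- An element of `R` in the gap below piece `m` is invertible on the first `m` pieces and zero on
the others. Differences of consecutive idempotents then isolate single pieces. -/
theorem exists_indicator_iUnion (P : IntervalPartition I) (m : ℕ) :
    ∃ e : S, ∀ (A : I) (k : Fin P.num), A.1 ∈ P.part k →
      (k.1 < m → φ A e = 1) ∧ (¬ k.1 < m → φ A e = 0) := by
  by_cases h0 : m = 0
  · exact ⟨0, fun A k _ => ⟨fun h => absurd h (by omega), fun _ => map_zero _⟩⟩
  by_cases h1 : P.num ≤ m
  · exact ⟨1, fun A k _ => ⟨fun _ => map_one _, fun h => absurd (k.2.trans_le h1) h⟩⟩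
  let a : Fin P.num := ⟨m - 1, by omega⟩
  let b : Fin P.num := ⟨m, by omega⟩
  obtain ⟨x, hxb, hxa⟩ := SetLike.exists_of_lt (AdmissibleInterval.lt_iff.1
    (P.lt_of_lt a b (Fin.mk_lt_mk.2 (by omega)) _ (P.isGreatest_top a).1 _ (P.isLeast_bot b).1))
  have hle : ∀ (A : AdmissibleInterval R) (k : Fin P.num), A ∈ P.part k → k.1 < m →
      A ≤ P.top a := fun A k hk hkm => by
    rcases (show k ≤ a from Fin.mk_le_mk.2 (by omega)).lt_or_eq with h | rfl
    · exact (P.lt_of_lt _ _ h _ hk _ (P.isGreatest_top a).1).le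
    · exact (P.isGreatest_top _).2 hk
  have hge : ∀ (A : AdmissibleInterval R) (k : Fin P.num), A ∈ P.part k → ¬ k.1 < m →
      P.bot b ≤ A := fun A k hk hkm => by
    rcases (show b ≤ k from Fin.mk_le_mk.2 (by omega)).lt_or_eq with h | rfl
    · exact (P.lt_of_lt _ _ h _ (P.isLeast_bot b).1 _ hk).le
    · exact (P.isLeast_bot _).2 hk
  have hX : ∀ (A : AdmissibleInterval R) (k : Fin P.num), A ∈ P.part k →
      (A ∈ {A | x ∉ A.hi.asIdeal} ↔ k.1 < m) := fun A k hk => by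
    constructor
    · intro hxA
      by_contra hkm
      exact hxA (A.le (AdmissibleInterval.lo_mono (hge A k hk hkm) hxb))
    · exact fun hkm hxA => hxa (AdmissibleInterval.hi_mono (hle A k hk hkm) hxA)
  obtain ⟨e, he⟩ := h.exists_indicator {A | x ∉ A.hi.asIdeal} x (fun A _ hA => hA) (by
    intro A hA hAX
    obtain ⟨k, hk⟩ := P.exists_mem_part ⟨A, hA⟩
    exact AdmissibleInterval.lo_mono (hge A k hk fun hkm => hAX ((hX A k hk).2 hkm)) hxb)
  refine ⟨e, fun A k hk => ⟨fun hkm => ?_, fun hkm => ?_⟩⟩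
  · exact (congrFun he A).trans (indicator_of_mem ((hX _ k hk).2 hkm))
  · exact (congrFun he A).trans (indicator_of_notMem fun h => hkm ((hX _ k hk).1 h))

theorem chainRing_le_range : chainRing I ≤ (AlgHom.pi φ).range := by
  refine iSup_le fun P s hs => ?_
  choose e he using h.exists_indicator_iUnion P
  let f : Fin P.num → S := fun l => e (l.1 + 1) - e l.1
  have hf1 : ∀ (A : I) (l : Fin P.num), A.1 ∈ P.part l → φ A (f l) = 1 := fun A l hA => by
    rw [map_sub, (he _ A l hA).1 (by omega), (he _ A l hA).2 (by omega), sub_zero]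
  have hf0 : ∀ (A : I) (k l : Fin P.num), A.1 ∈ P.part k → k ≠ l → φ A (f l) = 0 := by
    intro A k l hA hkl
    have hkl' : k.1 ≠ l.1 := fun h => hkl (Fin.ext h)
    by_cases hlt : k.1 < l.1
    · rw [map_sub, (he _ A k hA).1 (by omega), (he _ A k hA).1 (by omega), sub_self]
    · rw [map_sub, (he _ A k hA).2 (by omega), (he _ A k hA).2 (by omega), sub_self]
  have hfrac := P.mem_range_toProd_iff.1 hs
  choose a v hv hav using hfrac
  -- Completing by `1 - f l` makes the denominator a unit on all pieces, hence a unit of `S`, so the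
  -- fraction can be formed in `S` itself.
  have hu : ∀ l, IsUnit (algebraMap R S (v l) * f l + (1 - f l)) := fun l =>
    h.isUnit_of_forall _ fun A => by
      obtain ⟨k, hk⟩ := P.exists_mem_part A
      rw [map_add, map_sub, map_mul, map_one, AlgHom.commutes]
      by_cases hkl : k = l
      · subst hkl
        rw [hf1 A k hk, mul_one, sub_self, add_zero]
        exact LocQuot.isUnit_algebraMap fun h' =>
          hv k (AdmissibleInterval.hi_mono ((P.isGreatest_top k).2 hk) h')
      · rw [hf0 A k l hk hkl, mul_zero, sub_zero, zero_add]
        exact isUnit_one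
  choose y hy using fun l => (hu l).exists_right_inv
  refine ⟨∑ l, algebraMap R S (a l) * (f l * y l), funext fun A => ?_⟩
  obtain ⟨k, hk⟩ := P.exists_mem_part A
  change φ A _ = s A
  rw [map_sum, Finset.sum_eq_single k]
  · have h1 := congrArg (φ A) (hy k)
    rw [map_mul, map_add, map_sub, map_mul, map_one, AlgHom.commutes, hf1 A k hk, mul_one,
      sub_self, add_zero] at h1
    rw [map_mul, map_mul, AlgHom.commutes, hf1 A k hk, one_mul, ← hav k A hk]
    linear_combination s A * h1
  · intro l _ hlk
    rw [map_mul, map_mul, hf0 A k l hk hlk.symm, zero_mul, mul_zero]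
  · simp

/-- Near a maximal ideal, idempotents from `R_(𝓘)` form a basis of neighbourhoods. -/
theorem exists_idempotent (hI : IsClosedChain I) (A : I) {w : S} (hw : IsUnit (φ A w)) :
    ∃ e ∈ chainRing I, e A = 1 ∧ ∃ t : S, e = AlgHom.pi φ (w * t) := by
  let E : Set S := {e | AlgHom.pi φ e ∈ chainRing I ∧ φ A e = 1 ∧ e * e = e}
  -- Compactness argument: each point other than `A` is separated from `A` by a jump, so `w` and the
  -- complements of idempotents at `A` generate `S`. A product of finitely many of these idempotents
  -- is then a multiple of `w`.
  let J : Ideal S := Ideal.span {w} ⊔ Ideal.span ((1 - ·) '' E)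
  have hJ : J = ⊤ := by
    refine h.eq_top_of_forall J fun B => ?_
    by_cases hAB : A = B
    · subst hAB
      exact ⟨w, Ideal.mem_sup_left (Ideal.mem_span_singleton_self w), hw⟩
    · have hAB' : A.1 ≠ B.1 := fun h => hAB (Subtype.ext h)
      have hsep : ∃ X : Set (AdmissibleInterval R), indicator I X ∈ chainRing I ∧
          A.1 ∈ X ∧ B.1 ∉ X := by
        rcases hI.lt_or_le A.2 B.2 with hlt | hle
        · obtain ⟨C, hC, D, hD, h1, h2, h3, h4⟩ := hI.exists_jump A.2 B.2 hlt
          exact ⟨Set.Iic C, indicator_Iic_mem hI hC (Or.inr ⟨D, hD, h2, h4⟩), h1,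
            fun h' => (h2.trans_le (h3.trans h')).false⟩
        · obtain ⟨C, hC, D, hD, h1, h2, h3, h4⟩ :=
            hI.exists_jump B.2 A.2 (lt_of_le_of_ne hle hAB'.symm)
          exact ⟨Set.Ici D, indicator_Ici_mem hI hD (Or.inr ⟨C, hC, h2, h4⟩), h3,
            fun h' => (h2.trans_le (le_trans h' h1)).false⟩
      obtain ⟨X, hX, hAX, hBX⟩ := hsep
      obtain ⟨e, he : AlgHom.pi φ e = indicator I X⟩ := h.chainRing_le_range hX
      have hidem : e * e = e := h.injective (by
        rw [map_mul, he]
        funext B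
        by_cases hB : B.1 ∈ X
        · rw [Pi.mul_apply, indicator_of_mem hB, one_mul]
        · rw [Pi.mul_apply, indicator_of_notMem hB, zero_mul])
      have heE : e ∈ E := ⟨by rwa [he], (congrFun he A).trans (indicator_of_mem hAX), hidem⟩
      refine ⟨1 - e, Ideal.mem_sup_right (Ideal.subset_span ⟨e, heE, rfl⟩), ?_⟩
      have : φ B e = 0 := (congrFun he B).trans (indicator_of_notMem hBX)
      rw [map_sub, this, map_one, sub_zero]
      exact isUnit_one
  have hkill : ∀ y ∈ Ideal.span ((1 - ·) '' E), ∃ e ∈ E, e * y = 0 := fun y hy => by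
    induction hy using Submodule.span_induction with
    | mem y hy =>
      obtain ⟨e, he, rfl⟩ := hy
      exact ⟨e, he, by rw [mul_sub, mul_one, he.2.2, sub_self]⟩
    | zero => exact ⟨1, ⟨by rw [map_one]; exact one_mem _, map_one _, one_mul 1⟩, mul_zero _⟩
    | add y z _ _ hy hz =>
      obtain ⟨e, ⟨h1, h2, h3⟩, h4⟩ := hy
      obtain ⟨e', ⟨h1', h2', h3'⟩, h4'⟩ := hz
      refine ⟨e * e', ⟨?_, ?_, ?_⟩, ?_⟩
      · rw [map_mul]
        exact mul_mem h1 h1'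
      · rw [map_mul, h2, h2', one_mul]
      · rw [mul_mul_mul_comm, h3, h3']
      · linear_combination e' * h4 + e * h4'
    | smul a y _ hy =>
      obtain ⟨e, he, h4⟩ := hy
      exact ⟨e, he, by rw [smul_eq_mul, mul_left_comm, h4, mul_zero]⟩
  have h1J : (1 : S) ∈ J := hJ ▸ trivial
  obtain ⟨x, hx, y, hy, hxy⟩ := Submodule.mem_sup.1 h1J
  obtain ⟨t, rfl⟩ := Ideal.mem_span_singleton'.1 hx
  obtain ⟨e, he, hey⟩ := hkill y hy
  refine ⟨_, he.1, he.2.1, t * e, ?_⟩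
  congr 1
  linear_combination (-e) * hxy + hey

theorem range_eq (hI : IsClosedChain I) : (AlgHom.pi φ).range = chainRing I := by
  refine le_antisymm ?_ h.chainRing_le_range
  rintro _ ⟨s, rfl⟩
  change AlgHom.pi φ s ∈ chainRing I
  -- The conductor of the image of `s` into `R_(𝓘)`. At each point it contains an element with value
  -- `1`: an idempotent multiple of `w` makes `s` equal to `a / v` on its support, and `y` is `1 /
  -- v` up to a cut.
  let J : Ideal (chainRing I) :=
    { carrier := {t : chainRing I | t.1 * AlgHom.pi φ s ∈ chainRing I}
      add_mem' := fun {a b} ha hb => by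
        change (a.1 + b.1) * AlgHom.pi φ s ∈ chainRing I
        rw [add_mul]
        exact add_mem ha hb
      zero_mem' := by
        change (0 : ProdRing I) * AlgHom.pi φ s ∈ chainRing I
        rw [zero_mul]
        exact zero_mem _
      smul_mem' := fun c a ha => by
        change (c.1 * a.1) * AlgHom.pi φ s ∈ chainRing I
        rw [mul_assoc]
        exact mul_mem c.2 ha }
  suffices hJ : J = ⊤ by
    have h1 : (1 : chainRing I) ∈ J := hJ ▸ trivial
    change (1 : ProdRing I) * AlgHom.pi φ s ∈ chainRing I at h1
    rwa [one_mul] at h1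
  by_contra hJ
  obtain ⟨m, hm, hJm⟩ := Ideal.exists_le_maximal J hJ
  obtain ⟨A, hA⟩ := exists_isLocalPiece_of_isMaximal hI m hm
  obtain ⟨a, v, hv, hav⟩ := LocQuot.exists_frac (φ A s)
  obtain ⟨w, hw, hws⟩ := (h.piece A).exists_mul_eq_zero (algebraMap R S v * s - algebraMap R S a)
    (by rw [map_sub, map_mul, AlgHom.commutes, AlgHom.commutes, hav, sub_self])
  obtain ⟨e, he, heA, t, rfl⟩ := h.exists_idempotent hI A (((h.piece A).notMem_iff w).1 hw)
  obtain ⟨C, hC, hAC, hvC, hcut⟩ := hI.exists_cutAbove A.2 hv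
  obtain ⟨y, hy, hyB⟩ := exists_frac_of_cutAbove hI hC hcut 1 hvC
  have hvy := (hyB A).1 hAC
  have hes : AlgHom.pi φ (w * t) * algebraMap R _ v * AlgHom.pi φ s =
      AlgHom.pi φ (w * t) * algebraMap R _ a := by
    rw [← (AlgHom.pi φ).commutes v, ← (AlgHom.pi φ).commutes a, ← map_mul, ← map_mul, ← map_mul]
    congr 1
    linear_combination t * hws
  have hmem : (⟨_, mul_mem (mul_mem he (algebraMap_mem _ v)) hy⟩ : chainRing I) ∈ J := by
    change AlgHom.pi φ (w * t) * algebraMap R (ProdRing I) v * y * AlgHom.pi φ s ∈ chainRing I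
    rw [mul_right_comm, hes]
    exact mul_mem (mul_mem he (algebraMap_mem _ a)) hy
  refine (hA.notMem_iff _).2 ?_ (hJm hmem)
  rw [chainEval_mk]
  have : (AlgHom.pi φ (w * t) * algebraMap R (ProdRing I) v * y) A = 1 := by
    change AlgHom.pi φ (w * t) A * algebraMap R (LocQuot A.1.lo A.1.hi) v * y A = 1
    rw [heA, one_mul, hvy, map_one]
  rw [this]
  exact isUnit_one

/-- `S` is isomorphic to `R_(𝓘)`. -/
theorem exists_algEquiv (hI : IsClosedChain I) : Nonempty (S ≃ₐ[R] chainRing I) :=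
  ⟨(AlgEquiv.ofInjective (AlgHom.pi φ) h.injective).trans
    (Subalgebra.equivOfEq _ _ (h.range_eq hI))⟩

end HasPieces

theorem exists_hasPieces [IsDomain R] [ValuationRing R] (he : CEpi (algebraMap R S))
    (hS : ∀ s : S, IsIdem (Ideal.torsionOf R S s)) :
    ∃ n φ, HasPieces (intervalsOf (algebraMap R S)) S n φ := by
  choose n φ h using fun A : intervalsOf (algebraMap R S) => mem_intervalsOf_iff.1 A.2
  refine ⟨n, φ, h, fun m hm => ?_⟩
  obtain ⟨A, ψ, hA⟩ := exists_isLocalPiece he hS m hm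
  let A' : intervalsOf (algebraMap R S) := ⟨A, mem_intervalsOf_iff.2 ⟨m, ψ, hA⟩⟩
  have := hm.isPrime
  have := (h A').isMaximal.isPrime
  exact ⟨A', he.prime_eq_of_comap_eq (by rw [hA.comap_eq, (h A').comap_eq])⟩

end Reconstruction

/-! ### The classification -/

section Classification

variable {R S S' : Type u} [CommRing R] [CommRing S] [CommRing S']

theorem intervalsOf_subset_of_ringEquiv {f : R →+* S} {g : R →+* S'} (e : S ≃+* S')
    (he : ∀ r, e (f r) = g r) : intervalsOf f ⊆ intervalsOf g := by
  rintro A ⟨n, hn, hA, ψ, hψ⟩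
  have hn' : (n.comap e.symm).IsMaximal := Ideal.comap_isMaximal_of_equiv e.symm
  have hcomap : ∀ s, s ∈ n ↔ e s ∈ n.comap e.symm := fun s => by
    rw [Ideal.mem_comap, e.symm_apply_apply]
  have hmap : (n.comap e.symm).primeCompl.map e.symm.toMonoidHom = n.primeCompl := by
    ext s
    constructor
    · rintro ⟨t, ht, rfl⟩
      exact ht
    · exact fun hs => ⟨e s, fun h => hs ((hcomap s).2 h), e.symm_apply_apply s⟩
  refine ⟨_, hn', ?_, (IsLocalization.ringEquivOfRingEquiv
    (Localization.AtPrime (n.comap e.symm)) (Localization.AtPrime n) e.symm hmap).trans ψ,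
    fun r => ?_⟩
  · ext r
    rw [hA, Ideal.mem_comap, Ideal.mem_comap, hcomap, he]
  · rw [RingEquiv.trans_apply, IsLocalization.ringEquivOfRingEquiv_eq, ← he,
      e.symm_apply_apply, hψ]

theorem intervalsOf_eq_of_ringEquiv {f : R →+* S} {g : R →+* S'} (e : S ≃+* S')
    (he : ∀ r, e (f r) = g r) : intervalsOf f = intervalsOf g :=
  (intervalsOf_subset_of_ringEquiv e he).antisymm
    (intervalsOf_subset_of_ringEquiv e.symm fun r => by rw [← he, e.symm_apply_apply])

theorem HomEpi.intervals_eq_of_equiv {F G : HomEpi R} (h : F ≈ G) :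
    F.intervals = G.intervals := by
  let := F.commRing
  let := G.commRing
  obtain ⟨e, he⟩ := h
  exact intervalsOf_eq_of_ringEquiv e he

variable [IsDomain R] [ValuationRing R] {f : R →+* S}

theorem IsHomologicalEpi.isClosedChain_intervalsOf (hf : IsHomologicalEpi f) :
    IsClosedChain (intervalsOf f) :=
  letI := f.toAlgebra
  HomEpiVD.isClosedChain_intervalsOf (cEpi_of_epi hf.epi) (IsHomologicalEpi.isIdem_torsionOf hf)

theorem IsHomologicalEpi.exists_ringEquiv (hf : IsHomologicalEpi f) :
    ∃ e : S ≃+* chainRing (intervalsOf f), ∀ r, e (f r) = chainHom (intervalsOf f) r := by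
  let := f.toAlgebra
  obtain ⟨n, φ, h⟩ := exists_hasPieces (S := S) (cEpi_of_epi hf.epi)
    (IsHomologicalEpi.isIdem_torsionOf hf)
  obtain ⟨e⟩ := h.exists_algEquiv hf.isClosedChain_intervalsOf
  exact ⟨e.toRingEquiv, fun r => e.commutes r⟩

theorem HomEpi.isClosedChain_intervals (F : HomEpi R) : IsClosedChain F.intervals :=
  letI := F.commRing
  IsHomologicalEpi.isClosedChain_intervalsOf (f := F.hom) F.isHomologicalEpi

/-- The homological epimorphism `f_(𝓘)`. -/
def chainEpi (I : {I : Set (AdmissibleInterval R) // IsClosedChain I}) : HomEpi R :=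
  HomEpi.of (S := chainRing I.1) (chainHom I.1) (isHomologicalEpi_chainHom I.2)

theorem intervals_chainEpi (I : {I : Set (AdmissibleInterval R) // IsClosedChain I}) :
    (chainEpi I).intervals = I.1 :=
  intervalsOf_chainHom I.2

theorem HomEpi.equiv_chainEpi (F : HomEpi R) :
    F ≈ chainEpi ⟨F.intervals, F.isClosedChain_intervals⟩ :=
  letI := F.commRing
  IsHomologicalEpi.exists_ringEquiv (f := F.hom) F.isHomologicalEpi

variable (R) in
/-- Chains of admissible intervals that satisfy the closure conditions correspond to equivalence
classes of homological epimorphisms. -/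
def chainEquiv : {I : Set (AdmissibleInterval R) // IsClosedChain I} ≃ HomEpiClass R where
  toFun I := Quotient.mk _ (chainEpi I)
  invFun := Quotient.lift (fun F => ⟨F.intervals, F.isClosedChain_intervals⟩)
    fun _ _ h => Subtype.ext (HomEpi.intervals_eq_of_equiv h)
  left_inv I := Subtype.ext (intervals_chainEpi I)
  right_inv := by
    rintro ⟨F⟩
    exact Quotient.sound (Setoid.symm F.equiv_chainEpi)

end Classification

end HomEpiVD

end

theorem mainTheorem2 (R : Type u) [CommRing R] [IsDomain R] [ValuationRing R] :
    ∃ e : {I : Set (HomEpiVD.AdmissibleInterval R) // HomEpiVD.IsClosedChain I} ≃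
        HomEpiVD.HomEpiClass R,
      (∀ I : {I : Set (HomEpiVD.AdmissibleInterval R) // HomEpiVD.IsClosedChain I},
        ∃ h : HomEpiVD.IsHomologicalEpi (S := HomEpiVD.chainRing I.1) (HomEpiVD.chainHom I.1),
          e I = Quotient.mk (HomEpiVD.homEpiSetoid R)
            (HomEpiVD.HomEpi.of (S := HomEpiVD.chainRing I.1) (HomEpiVD.chainHom I.1) h)) ∧
      (∀ F : HomEpiVD.HomEpi R,
        (e.symm (Quotient.mk (HomEpiVD.homEpiSetoid R) F)).1 = F.intervals) :=
  ⟨HomEpiVD.chainEquiv R, fun I => ⟨HomEpiVD.isHomologicalEpi_chainHom I.2, rfl⟩, fun _ => rfl⟩
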